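/- Let $(M_1,\Pi_1)$ and $(M_2,\Pi_2)$ be (nonempty, finite-dimensional, smooth, boundaryless) Poisson manifolds with Riemannian metrics $\bar g_1$ and $\bar g_2$, let $f_1,\nu_1\in C^\infty(M_1)$ with $f_1>0$, and suppose that $f_1$ is a Casimir function of $\Pi_1$, i.e. $\Pi_1(df_1,dh)=0$ for all $h\in C^\infty(M_1)$. Let $M=M_1\times M_2$ carry the bivector field $\Pi^{\nu_1}=\Pi_1+\nu_1\Pi_2$ (with $\Pi_1,\Pi_2,\nu_1$ lifted to the product) and the cometric $\tilde g^{f_1}$ of the warped metric $\bar g^{f_1}=\pi_1^*\bar g_1+(f_1\circ\pi_1)^2\pi_2^*\bar g_2$. For a manifold $N$ with bivector field $\Pi$ and cometric $\tilde g$ of a metric, write $\eta(\sharp_\Pi\omega)=\Pi(\omega,\eta)$ and $[\omega,\eta]_\Pi=\mathcal L_{\sharp_\Pi\omega}\eta-\mathcal L_{\sharp_\Pi\eta}\omega-d(\Pi(\omega,\eta))$ for smooth one-forms $\omega,\eta$. Let $\mathcal D$ be the contravariant Levi-Civita connection of $(\Pi,\tilde g)$, i.e. the unique contravariant connection on $T^*N$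 with $\mathcal D_\omega\eta-\mathcal D_\eta\omega=[\omega,\eta]_\Pi$ and $\sharp_\Pi(\omega)\,\tilde g(\eta,\gamma)=\tilde g(\mathcal D_\omega\eta,\gamma)+\tilde g(\eta,\mathcal D_\omega\gamma)$, and put $\mathcal R(\omega,\eta)\gamma=\mathcal D_\omega\mathcal D_\eta\gamma-\mathcal D_\eta\mathcal D_\omega\gamma-\mathcal D_{[\omega,\eta]_\Pi}\gamma$. We say that $(N,\Pi,\tilde g)$ has positive sectional curvature if for every $p\in N$ and all smooth one-forms $\omega,\eta$ on $N$ that are linearly independent at $p$, $$\mathcal K_p(\omega,\eta)=\frac{\tilde g_p(\mathcal R(\omega,\eta)\eta,\omega)}{\tilde g_p(\omega,\omega)\,\tilde g_p(\eta,\eta)-\tilde g_p(\omega,\eta)^2}>0 .$$ If $(M,\Pi^{\nu_1},\tilde g^{f_1})$ has positive sectional curvature, then $(M_1,\Pi_1,\tilde g_1)$ and $(M_2,\Pi_2,\tilde g_2)$ are Poisson manifolds of positive sectional curvature. -/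

import Mathlib

open Bundle Manifold VectorField
open scoped ContDiff Manifold Topology

set_option maxSynthPendingDepth 3

noncomputable section

/-- The bilinear form `(v, w) ↦ B (A v, A w)`. -/
def pullbackBilin {V W : Type*} [AddCommGroup V] [Module ℝ V] [TopologicalSpace V]
    [AddCommGroup W] [Module ℝ W] [TopologicalSpace W]
    (B : W →L[ℝ] W →L[ℝ] ℝ) (A : V →L[ℝ] W) : V →L[ℝ] V →L[ℝ] ℝ :=
  (A.precomp ℝ).comp (B.comp A)

theorem pullbackBilin_apply {V W : Type*} [AddCommGroup V] [Module ℝ V] [TopologicalSpace V]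
    [AddCommGroup W] [Module ℝ W] [TopologicalSpace W]
    (B : W →L[ℝ] W →L[ℝ] ℝ) (A : V →L[ℝ] W) (v w : V) :
    pullbackBilin B A v w = B (A v) (A w) := rfl

section Tensors

variable {E : Type*} [NormedAddCommGroup E] [NormedSpace ℝ E]
  {H : Type*} [TopologicalSpace H] (I : ModelWithCorners ℝ E H)
  {M : Type*} [TopologicalSpace M] [ChartedSpace H M]

/-- The cotangent space `T*ₓM`. -/
abbrev CotangentSpace (x : M) : Type _ := TangentSpace I x →L[ℝ] ℝ

variable (M) in
/-- Smooth vector fields on `M`. -/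
abbrev SmoothVectorField [IsManifold I ∞ M] : Type _ :=
  ContMDiffSection I E ∞ (fun x : M => TangentSpace I x)

variable (M) in
/-- Smooth one-forms on `M`: smooth sections of the cotangent bundle. -/
abbrev OneForm [IsManifold I ∞ M] : Type _ :=
  ContMDiffSection I (E →L[ℝ] ℝ) ∞ (fun x : M => TangentSpace I x →L[ℝ] Trivial M ℝ x)

variable (M) in
/-- Fields of contravariant two-tensors, as bilinear forms on the cotangent spaces. -/
abbrev ContraTwoTensor : Type _ :=
  (x : M) → CotangentSpace I x →L[ℝ] CotangentSpace I x →L[ℝ] ℝ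

variable (M) in
/-- Fields of covariant two-tensors, as bilinear forms on the tangent spaces. -/
abbrev CoTwoTensor : Type _ :=
  (x : M) → TangentSpace I x →L[ℝ] TangentSpace I x →L[ℝ] ℝ

variable {I}

instance finiteDimensional_tangentSpace [FiniteDimensional ℝ E] (x : M) :
    FiniteDimensional ℝ (TangentSpace I x) :=
  inferInstanceAs (FiniteDimensional ℝ E)

instance t2Space_tangentSpace (x : M) : T2Space (TangentSpace I x) :=
  inferInstanceAs (T2Space E)

/-- The anchor `♯_Π : T*ₓM → TₓM` of `Π`: the vector `♯_Π α` with `β (♯_Π α) = Π (α, β)` for all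
covectors `β`, see `apply_anchor`. -/
def anchor [FiniteDimensional ℝ E] (P : ContraTwoTensor I M) (x : M) (α : CotangentSpace I x) :
    TangentSpace I x :=
  (Module.evalEquiv ℝ (TangentSpace I x)).symm
    ((P x α).toLinearMap ∘ₗ LinearMap.toContinuousLinearMap.toLinearMap)

theorem apply_anchor [FiniteDimensional ℝ E] (P : ContraTwoTensor I M) (x : M)
    (α β : CotangentSpace I x) : β (anchor P x α) = P x α β := by
  have h := Module.apply_evalEquiv_symm_apply (R := ℝ) (M := TangentSpace I x) β.toLinearMap
    ((P x α).toLinearMap ∘ₗ LinearMap.toContinuousLinearMap.toLinearMap)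
  exact h

/-- The bracket `{f, h} = Π (df, dh)` of two functions. -/
def poissonBracket (P : ContraTwoTensor I M) (f h : M → ℝ) : M → ℝ :=
  fun x => P x (mvfderiv I f x) (mvfderiv I h x)

/-- `Π` is a Poisson tensor: a smooth bivector field whose bracket satisfies the Jacobi identity,
that is, whose Schouten bracket with itself vanishes. -/
structure IsPoissonTensor [IsManifold I ∞ M] (P : ContraTwoTensor I M) : Prop where
  smooth : ContMDiff I (I.prod 𝓘(ℝ, (E →L[ℝ] ℝ) →L[ℝ] (E →L[ℝ] ℝ) →L[ℝ] ℝ)) ∞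
    (fun x => TotalSpace.mk' ((E →L[ℝ] ℝ) →L[ℝ] (E →L[ℝ] ℝ) →L[ℝ] ℝ)
      (E := fun x : M => (TangentSpace I x →L[ℝ] Trivial M ℝ x) →L[ℝ]
        (TangentSpace I x →L[ℝ] Trivial M ℝ x) →L[ℝ] Trivial M ℝ x) x (P x))
  skew : ∀ (x : M) (α β : CotangentSpace I x), P x α β = - P x β α
  jacobi : ∀ f h k : C^∞⟮I, M; ℝ⟯, ∀ x : M,
    poissonBracket P (poissonBracket P f h) k x + poissonBracket P (poissonBracket P h k) f x +
      poissonBracket P (poissonBracket P k f) h x = 0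

/-- `f` is a Casimir function of `Π`. -/
def IsCasimir (P : ContraTwoTensor I M) (f : M → ℝ) : Prop :=
  ∀ h : C^∞⟮I, M; ℝ⟯, ∀ x : M, poissonBracket P f h x = 0

/-- The musical map `♯_g : T*ₓM → TₓM` of a metric `g`, inverse to `v ↦ g (v, ·)`. -/
def metricSharp (g : CoTwoTensor I M) (x : M) : CotangentSpace I x →L[ℝ] TangentSpace I x :=
  (g x).inverse

/-- The cometric `(α, β) ↦ g (♯_g α, ♯_g β)` of a metric `g`. -/
def cometric (g : CoTwoTensor I M) : ContraTwoTensor I M :=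
  fun x => pullbackBilin (g x) (metricSharp g x)

/-- The function `(𝓛_X β)(Y) = X (β Y) - β [X, Y]`, for a one-form `β` and vector fields
`X` and `Y`. -/
def lieDerivativeApply (X : (x : M) → TangentSpace I x) (β : (x : M) → CotangentSpace I x)
    (Y : (x : M) → TangentSpace I x) : M → ℝ :=
  fun x => mvfderiv I (fun y => β y (Y y)) x (X x) - β x (mlieBracket I X Y x)

section Connections

variable [FiniteDimensional ℝ E] [IsManifold I ∞ M]

/-- `θ = [α, β]_Π`, that is, `θ = 𝓛_{♯α} β - 𝓛_{♯β} α - d (Π (α, β))` (both sides evaluated on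
arbitrary smooth vector fields `Y`). -/
def IsFormBracket (P : ContraTwoTensor I M) (α β θ : OneForm I M) : Prop :=
  ∀ (Y : SmoothVectorField I M) (x : M),
    θ x (Y x) = lieDerivativeApply (fun y => anchor P y (α y)) β Y x
      - lieDerivativeApply (fun y => anchor P y (β y)) α Y x
      - mvfderiv I (fun y => P y (α y) (β y)) x (Y x)

/-- The bracket `[α, β]_Π` of one-forms: the unique smooth one-form satisfying its defining
formula. -/
def formBracket (P : ContraTwoTensor I M) (α β : OneForm I M) : OneForm I M :=
  Classical.epsilon (IsFormBracket P α β)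

variable (I M) in
/-- A contravariant connection on the cotangent bundle of `(M, Π)`. -/
structure ContravariantConnection (P : ContraTwoTensor I M) where
  /-- The contravariant derivative `(α, β) ↦ 𝓓_α β`. -/
  D : OneForm I M → OneForm I M → OneForm I M
  add_left : ∀ α α' β, D (α + α') β = D α β + D α' β
  add_right : ∀ α β β', D α (β + β') = D α β + D α β'
  /-- `𝓓_{f α} β = f 𝓓_α β` -/
  smul_left : ∀ (f : C^∞⟮I, M; ℝ⟯) (α α' β : OneForm I M), (∀ x, α' x = f x • α x) →
    ∀ x, D α' β x = f x • D α β x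
  /-- `𝓓_α (f β) = f 𝓓_α β + (♯α)(f) β` -/
  leibniz : ∀ (f : C^∞⟮I, M; ℝ⟯) (α β β' : OneForm I M), (∀ x, β' x = f x • β x) →
    ∀ x, D α β' x = f x • D α β x + mvfderiv I f x (anchor P x (α x)) • β x

namespace ContravariantConnection

variable {P : ContraTwoTensor I M}

/-- `𝓓` is the contravariant Levi-Civita connection of `(Π, g)`: it is torsion free,
`𝓓_α β - 𝓓_β α = [α, β]_Π`, and the cometric is parallel. -/
structure IsLeviCivita (D : ContravariantConnection I M P) (g : CoTwoTensor I M) : Prop where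
  torsion_free : ∀ α β : OneForm I M, IsFormBracket P α β (D.D α β - D.D β α)
  metric : ∀ (α β γ : OneForm I M) (x : M),
    mvfderiv I (fun y => cometric g y (β y) (γ y)) x (anchor P x (α x)) =
      cometric g x (D.D α β x) (γ x) + cometric g x (β x) (D.D α γ x)

/-- The curvature `𝓡(α, β)γ = 𝓓_α 𝓓_β γ - 𝓓_β 𝓓_α γ - 𝓓_{[α, β]_Π} γ`. -/
def curvature (D : ContravariantConnection I M P) (α β γ : OneForm I M) : OneForm I M :=
  D.D α (D.D β γ) - D.D β (D.D α γ) - D.D (formBracket P α β) γ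

/-- The sectional curvature at `x` of the plane spanned by `α x` and `β x`. -/
def sectionalCurvature (D : ContravariantConnection I M P) (g : CoTwoTensor I M)
    (α β : OneForm I M) (x : M) : ℝ :=
  cometric g x (D.curvature α β β x) (α x) /
    (cometric g x (α x) (α x) * cometric g x (β x) (β x) - cometric g x (α x) (β x) ^ 2)

end ContravariantConnection

/-- `(M, Π, g)` has positive sectional curvature: for its contravariant Levi-Civita connection,
the sectional curvature of any two smooth one-forms is positive at every point where they are
linearly independent. -/
def HasPositiveSectionalCurvature (P : ContraTwoTensor I M) (g : CoTwoTensor I M) : Prop :=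
  ∃ D : ContravariantConnection I M P, D.IsLeviCivita g ∧
    ∀ (x : M) (α β : OneForm I M), LinearIndependent ℝ ![α x, β x] →
      0 < D.sectionalCurvature g α β x

end Connections

end Tensors

section WarpedProduct

variable {E₁ : Type*} [NormedAddCommGroup E₁] [NormedSpace ℝ E₁]
  {H₁ : Type*} [TopologicalSpace H₁] {I₁ : ModelWithCorners ℝ E₁ H₁}
  {M₁ : Type*} [TopologicalSpace M₁] [ChartedSpace H₁ M₁]
  {E₂ : Type*} [NormedAddCommGroup E₂] [NormedSpace ℝ E₂]
  {H₂ : Type*} [TopologicalSpace H₂] {I₂ : ModelWithCorners ℝ E₂ H₂}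
  {M₂ : Type*} [TopologicalSpace M₂] [ChartedSpace H₂ M₂]

/-- The warped metric `π₁* g₁ + (f ∘ π₁)² π₂* g₂` on `M₁ × M₂`. -/
def warpedMetric (g₁ : CoTwoTensor I₁ M₁) (g₂ : CoTwoTensor I₂ M₂) (f : M₁ → ℝ) :
    CoTwoTensor (I₁.prod I₂) (M₁ × M₂) :=
  fun x =>
    pullbackBilin (g₁ x.1) (mfderiv (I₁.prod I₂) I₁ Prod.fst x)
      + f x.1 ^ 2 • pullbackBilin (g₂ x.2) (mfderiv (I₁.prod I₂) I₂ Prod.snd x)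

/-- The restriction to the slice `M₁ × {x.2}` of a covector at `x`. -/
def restrictFst (x : M₁ × M₂) :
    CotangentSpace (I₁.prod I₂) x →L[ℝ] CotangentSpace I₁ x.1 :=
  (mfderiv I₁ (I₁.prod I₂) (fun y : M₁ => (y, x.2)) x.1).precomp ℝ

/-- The restriction to the slice `{x.1} × M₂` of a covector at `x`. -/
def restrictSnd (x : M₁ × M₂) :
    CotangentSpace (I₁.prod I₂) x →L[ℝ] CotangentSpace I₂ x.2 :=
  (mfderiv I₂ (I₁.prod I₂) (fun y : M₂ => (x.1, y)) x.2).precomp ℝ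

/-- The warped bivector field `Π₁ + ν Π₂` on `M₁ × M₂`, where `Π₁` and `Π₂` are lifted to the
product and `ν` stands for `ν ∘ π₁`. -/
def warpedBivector (P₁ : ContraTwoTensor I₁ M₁) (P₂ : ContraTwoTensor I₂ M₂) (ν : M₁ → ℝ) :
    ContraTwoTensor (I₁.prod I₂) (M₁ × M₂) :=
  fun x => pullbackBilin (P₁ x.1) (restrictFst (I₁ := I₁) (I₂ := I₂) x)
    + ν x.1 • pullbackBilin (P₂ x.2) (restrictSnd (I₁ := I₁) (I₂ := I₂) x)

end WarpedProduct

end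

/-! Write `α^h` and `α^v` for the lifts to `M₁ × M₂` of a one-form `α` on the first or second factor
(horizontal and vertical forms). The proof determines the Levi-Civita connection `𝓓` of the warped
product on pairs of lifts from the same factor and compares the curvature of horizontal and vertical
planes with that of the factors.

Lifted forms have simple brackets: `[α^h, β^h] = [α, β]^h`, `[α^h, β^v] = 0` and `[α^v, β^v] = ν [α,
β]^v + Π₂(α, β) dν^h` (`bracketApply_liftFst_liftFst` and its two companions). Together with
compatibility with the cometric this gives `𝓓_{α^h} β^h = (𝓓¹_α β)^h` (`liftFst_liftFst`). Since `f`
is Casimir, `df` kills the horizontal anchors, and `𝓓_{α^v} β^v = ν (𝓓²_α β)^v + ½ Π₂(α, β) dν^h`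
follows (`liftSnd_liftSnd`).

Hence a horizontal plane has exactly the curvature it has in `M₁` (`sectionalCurvature_liftFst`),
while on a vertical plane (`cometric_curvature_liftSnd`) `g̃(𝓡(α^v, β^v) β^v, α^v) = f⁻² ν²
g̃₂(𝓡₂(α, β) β, α) - ¾ Π₂(α, β)² |dν|²`. The correction is nonpositive, so at a point `p` with `ν p
≠ 0` positivity on the product forces positivity on `M₂`. If `ν` vanishes identically, vertical
planes are flat; positivity then leaves no independent pair of forms on `M₂`, so `Π₂ = 0` and the
claim for `M₂` is vacuous.

The Levi-Civita connections of the factors must be exhibited. They are read off from `𝓓`: `𝓓¹` by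
restriction to a slice `M₁ × {q}`, and `𝓓²` by restriction to `{p} × M₂` followed by division by `ν
p`. -/

noncomputable section

/-! ### Lie brackets as commutators of derivations, and related vector fields -/

section LieBracket

variable {E : Type*} [NormedAddCommGroup E] [NormedSpace ℝ E]
  {H : Type*} [TopologicalSpace H] {I : ModelWithCorners ℝ E H}
  {M : Type*} [TopologicalSpace M] [ChartedSpace H M]
  {F : Type*} [NormedAddCommGroup F] [NormedSpace ℝ F]

theorem mvfderiv_eq_fderivWithin {φ : M → F} {x : M} (h : MDifferentiableAt I 𝓘(ℝ, F) φ x) :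
    mvfderiv I φ x
      = fderivWithin ℝ (φ ∘ (extChartAt I x).symm) (Set.range I) (extChartAt I x x) := by
  exact h.mfderiv

variable [IsManifold I ∞ M]

/-- Chain rule: the derivative of the inverse chart cancels against its inverse in the pullback of
`W`. The identity is needed near the base point and not only at it, because it is differentiated
once more. -/
theorem eventually_fderivWithin_mpullbackWithin {φ : M → F} {x : M}
    (hφ : ContMDiffAt I 𝓘(ℝ, F) 2 φ x) (W : (y : M) → TangentSpace I y) :
    ∀ᶠ z in 𝓝[Set.range I] (extChartAt I x x),
      fderivWithin ℝ (φ ∘ (extChartAt I x).symm) (Set.range I) z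
        (mpullbackWithin 𝓘(ℝ, E) I (extChartAt I x).symm W (Set.range I) z)
      = mvfderiv I φ ((extChartAt I x).symm z) (W ((extChartAt I x).symm z)) := by
  have : IsManifold I 1 M := IsManifold.of_le (n := ∞) (by simp)
  have : IsManifold I 2 M := IsManifold.of_le (n := ∞) (ENat.LEInfty.out)
  have h1 : ∀ᶠ y in 𝓝 x, ContMDiffAt I 𝓘(ℝ, F) 2 φ y := contMDiffAt_iff_contMDiffAt_nhds (by simp) |>.1 hφ
  have hc : Filter.Tendsto (extChartAt I x).symm (𝓝[Set.range I] (extChartAt I x x)) (𝓝 x) := by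
    have := (continuousAt_extChartAt_symm (I := I) x).tendsto
    rw [extChartAt_to_inv] at this
    exact this.mono_left nhdsWithin_le_nhds
  filter_upwards [hc.eventually h1, extChartAt_target_mem_nhdsWithin x] with z hz hzt
  have hd : MDifferentiableAt I 𝓘(ℝ, F) φ ((extChartAt I x).symm z) :=
    hz.mdifferentiableAt (by simp)
  have hU : UniqueMDiffWithinAt 𝓘(ℝ, E) (Set.range I) z :=
    I.uniqueMDiffOn _ (extChartAt_target_subset_range x hzt)
  have hs := mdifferentiableWithinAt_extChartAt_symm (I := I) hzt
  have e1 : fderivWithin ℝ (φ ∘ (extChartAt I x).symm) (Set.range I) z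
      = (mfderiv I 𝓘(ℝ, F) φ ((extChartAt I x).symm z)).comp
        (mfderivWithin 𝓘(ℝ, E) I (extChartAt I x).symm (Set.range I) z) := by
    rw [← mfderiv_comp_mfderivWithin z hd hs hU, mfderivWithin_eq_fderivWithin]
  have hinv := isInvertible_mfderivWithin_extChartAt_symm (I := I) hzt
  rw [e1]
  change (mfderiv I 𝓘(ℝ, F) φ ((extChartAt I x).symm z))
    ((mfderivWithin 𝓘(ℝ, E) I (extChartAt I x).symm (Set.range I) z)
      ((mfderivWithin 𝓘(ℝ, E) I (extChartAt I x).symm (Set.range I) z).inverse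
        (W ((extChartAt I x).symm z)))) = _
  rw [hinv.self_apply_inverse]
  rfl

omit [IsManifold I ∞ M] in
theorem contDiffWithinAt_comp_extChartAt_symm {φ : M → F} {x : M}
    (hφ : ContMDiffAt I 𝓘(ℝ, F) 2 φ x) :
    ContDiffWithinAt ℝ 2 (φ ∘ (extChartAt I x).symm) (Set.range I) (extChartAt I x x) :=
  (contMDiffAt_iff.1 hφ).2

theorem differentiableWithinAt_mpullbackWithin_extChartAt_symm [CompleteSpace E] {x : M}
    {W : (y : M) → TangentSpace I y}
    (hW : MDifferentiableAt I I.tangent (fun y => (W y : TangentBundle I M)) x) :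
    DifferentiableWithinAt ℝ (mpullbackWithin 𝓘(ℝ, E) I (extChartAt I x).symm W (Set.range I))
      (Set.range I) (extChartAt I x x) := by
  have : IsManifold I 2 M := IsManifold.of_le (n := ∞) (ENat.LEInfty.out)
  have h := MDifferentiableWithinAt.differentiableWithinAt_mpullbackWithin_vectorField
    (s := Set.univ) (hW.mdifferentiableWithinAt)
  rwa [Set.preimage_univ, Set.univ_inter] at h

theorem differentiableWithinAt_fderivWithin_mpullbackWithin [CompleteSpace E] {φ : M → F} {x : M}
    (hφ : ContMDiffAt I 𝓘(ℝ, F) 2 φ x) {W : (y : M) → TangentSpace I y}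
    (hW : MDifferentiableAt I I.tangent (fun y => (W y : TangentBundle I M)) x) :
    DifferentiableWithinAt ℝ (fun z => fderivWithin ℝ (φ ∘ (extChartAt I x).symm) (Set.range I) z
      (mpullbackWithin 𝓘(ℝ, E) I (extChartAt I x).symm W (Set.range I) z)) (Set.range I)
        (extChartAt I x x) := by
  have hmem : extChartAt I x x ∈ Set.range I := ⟨_, rfl⟩
  have h0 : DifferentiableWithinAt ℝ
      (fderivWithin ℝ (φ ∘ (extChartAt I x).symm) (Set.range I)) (Set.range I)
        (extChartAt I x x) :=
    ((contDiffWithinAt_comp_extChartAt_symm hφ).fderivWithin_right I.uniqueDiffOn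
      (m := 1) (by norm_num) hmem).differentiableWithinAt one_ne_zero
  exact h0.clm_apply (differentiableWithinAt_mpullbackWithin_extChartAt_symm hW)

theorem mdifferentiableAt_mvfderiv_apply [CompleteSpace E] {φ : M → F} {x : M}
    (hφ : ContMDiffAt I 𝓘(ℝ, F) 2 φ x) {W : (y : M) → TangentSpace I y}
    (hW : MDifferentiableAt I I.tangent (fun y => (W y : TangentBundle I M)) x) :
    MDifferentiableAt I 𝓘(ℝ, F) (fun y => mvfderiv I φ y (W y)) x := by
  have : IsManifold I 1 M := IsManifold.of_le (n := ∞) (by simp)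
  have h1 := differentiableWithinAt_fderivWithin_mpullbackWithin hφ hW
  have h2 := (eventually_fderivWithin_mpullbackWithin hφ W)
  have he : MDifferentiableAt I 𝓘(ℝ, E) (extChartAt I x) x :=
    mdifferentiableAt_extChartAt (mem_chart_source H x)
  have h3 := h1.mdifferentiableWithinAt.comp (M := M) (I := I) (s := Set.univ) x
    he.mdifferentiableWithinAt (fun y _ => ⟨_, rfl⟩)
  rw [mdifferentiableWithinAt_univ] at h3
  refine h3.congr_of_eventuallyEq ?_
  have hc : Filter.Tendsto (extChartAt I x) (𝓝 x) (𝓝[Set.range I] (extChartAt I x x)) :=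
    tendsto_nhdsWithin_iff.2 ⟨continuousAt_extChartAt x, Filter.Eventually.of_forall
      fun y => ⟨_, rfl⟩⟩
  filter_upwards [hc.eventually h2, extChartAt_source_mem_nhds (I := I) x] with y hy hys
  rw [(extChartAt I x).left_inv hys] at hy
  exact hy.symm

/-- In the chart at `x` this is the symmetry of the second derivative of `φ`. Vector values are
allowed so that `φ` may be built from a chart. -/
theorem mvfderiv_mlieBracket [CompleteSpace E] {φ : M → F} {x : M}
    (hφ : ContMDiffAt I 𝓘(ℝ, F) 2 φ x) {V W : (y : M) → TangentSpace I y}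
    (hV : MDifferentiableAt I I.tangent (fun y => (V y : TangentBundle I M)) x)
    (hW : MDifferentiableAt I I.tangent (fun y => (W y : TangentBundle I M)) x) :
    mvfderiv I φ x (mlieBracket I V W x)
      = mvfderiv I (fun y => mvfderiv I φ y (W y)) x (V x)
        - mvfderiv I (fun y => mvfderiv I φ y (V y)) x (W x) := by
  have : IsManifold I 1 M := IsManifold.of_le (n := ∞) (by simp)
  have : IsManifold I 2 M := IsManifold.of_le (n := ∞) (ENat.LEInfty.out)
  have hmem : extChartAt I x x ∈ Set.range I := ⟨_, rfl⟩
  have hφ' := contDiffWithinAt_comp_extChartAt_symm hφ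
  have key : ∀ {U : (y : M) → TangentSpace I y},
      MDifferentiableAt I I.tangent (fun y => (U y : TangentBundle I M)) x →
      mvfderiv I (fun y => mvfderiv I φ y (U y)) x =
      fderivWithin ℝ (fun z => fderivWithin ℝ (φ ∘ (extChartAt I x).symm) (Set.range I) z
        (mpullbackWithin 𝓘(ℝ, E) I (extChartAt I x).symm U (Set.range I) z)) (Set.range I)
          (extChartAt I x x) := by
    intro U hU
    have h2 := eventually_fderivWithin_mpullbackWithin hφ U
    rw [mvfderiv_eq_fderivWithin (mdifferentiableAt_mvfderiv_apply hφ hU)]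
    exact (Filter.EventuallyEq.fderivWithin_eq h2 (h2.self_of_nhdsWithin hmem)).symm
  have hb : mlieBracket I V W x = lieBracketWithin ℝ
      (mpullbackWithin 𝓘(ℝ, E) I (extChartAt I x).symm V (Set.range I))
      (mpullbackWithin 𝓘(ℝ, E) I (extChartAt I x).symm W (Set.range I))
      (Set.range I) (extChartAt I x x) := by
    rw [← mlieBracketWithin_univ, mlieBracketWithin_apply, mfderiv_extChartAt_self]
    rw [Set.preimage_univ, Set.univ_inter]
    exact congrArg (fun A : E →L[ℝ] E => A _) (ContinuousLinearMap.inverse_id (R := ℝ) (M := E))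
  have hv : ∀ U : (y : M) → TangentSpace I y,
      mpullbackWithin 𝓘(ℝ, E) I (extChartAt I x).symm U (Set.range I) (extChartAt I x x)
        = U x := by
    intro U
    have h := mfderivWithin_extChartAt_symm_inverse_apply (I := I) (x := x)
      (U ((extChartAt I x).symm (extChartAt I x x)))
    rw [extChartAt_to_inv] at h
    rw [mpullbackWithin_apply]
    rw [extChartAt_to_inv]
    exact h
  rw [key hV, key hW, hb, mvfderiv_eq_fderivWithin (hφ.mdifferentiableAt (by simp)), ← hv V, ← hv W]
  exact fderivWithin_apply_lieBracket (E := E) (n := 2) hφ' (by simp) I.uniqueDiffOn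
    (I.range_subset_closure_interior hmem) hmem
    (differentiableWithinAt_mpullbackWithin_extChartAt_symm hW)
    (differentiableWithinAt_mpullbackWithin_extChartAt_symm hV)

variable {E' : Type*} [NormedAddCommGroup E'] [NormedSpace ℝ E']
  {H' : Type*} [TopologicalSpace H'] {J : ModelWithCorners ℝ E' H'}
  {N : Type*} [TopologicalSpace N] [ChartedSpace H' N] [IsManifold J ∞ N]

omit [IsManifold I ∞ M] [IsManifold J ∞ N] in
theorem mvfderiv_comp_map {G : N → F} {Φ : M → N} {x : M} (hG : MDifferentiableAt J 𝓘(ℝ, F) G (Φ x))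
    (hΦ : MDifferentiableAt I J Φ x) (v : TangentSpace I x) :
    mvfderiv I (fun y => G (Φ y)) x v = mvfderiv J G (Φ x) (mfderiv I J Φ x v) :=
  mfderiv_comp_apply x hG hΦ v

/-- The bracket of related vector fields is related to the bracket. -/
theorem mfderiv_mlieBracket_of_related [CompleteSpace E] [CompleteSpace E'] {Φ : M → N}
    (hΦ : ContMDiff I J ∞ Φ) {V W : (y : M) → TangentSpace I y}
    {V' W' : (y : N) → TangentSpace J y} {x : M}
    (hV : MDifferentiableAt I I.tangent (fun y => (V y : TangentBundle I M)) x)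
    (hW : MDifferentiableAt I I.tangent (fun y => (W y : TangentBundle I M)) x)
    (hV' : MDifferentiableAt J J.tangent (fun y => (V' y : TangentBundle J N)) (Φ x))
    (hW' : MDifferentiableAt J J.tangent (fun y => (W' y : TangentBundle J N)) (Φ x))
    (hVV' : ∀ y, mfderiv I J Φ y (V y) = V' (Φ y)) (hWW' : ∀ y, mfderiv I J Φ y (W y) = W' (Φ y)) :
    mfderiv I J Φ x (mlieBracket I V W x) = mlieBracket J V' W' (Φ x) := by
  have : IsManifold J 1 N := IsManifold.of_le (n := ∞) (by simp)
  have he : ContMDiffAt J 𝓘(ℝ, E') ∞ (extChartAt J (Φ x)) (Φ x) := contMDiffAt_extChartAt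
  have he2 : ContMDiffAt J 𝓘(ℝ, E') 2 (extChartAt J (Φ x)) (Φ x) :=
    he.of_le (ENat.LEInfty.out)
  have hΦ2 : ContMDiffAt I J 2 Φ x := hΦ.contMDiffAt.of_le (ENat.LEInfty.out)
  have hd : ∀ y, MDifferentiableAt I J Φ y := fun y => hΦ.contMDiffAt.mdifferentiableAt (by simp)
  have hnear : ∀ᶠ y in 𝓝 x, MDifferentiableAt J 𝓘(ℝ, E') (extChartAt J (Φ x)) (Φ y) := by
    filter_upwards [hΦ.continuous.continuousAt.preimage_mem_nhds
      ((chartAt H' (Φ x)).open_source.mem_nhds (mem_chart_source H' (Φ x)))] with y hy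
    exact mdifferentiableAt_extChartAt hy
  have key : ∀ {U : (y : M) → TangentSpace I y} {U' : (y : N) → TangentSpace J y},
      MDifferentiableAt J J.tangent (fun y => (U' y : TangentBundle J N)) (Φ x) →
      (∀ y, mfderiv I J Φ y (U y) = U' (Φ y)) → ∀ v,
      mvfderiv I (fun y => mvfderiv I (fun y => extChartAt J (Φ x) (Φ y)) y (U y)) x v
        = mvfderiv J (fun y => mvfderiv J (extChartAt J (Φ x)) y (U' y)) (Φ x)
          (mfderiv I J Φ x v) := by
    intro U U' hU' hUU' v
    rw [← mvfderiv_comp_map (mdifferentiableAt_mvfderiv_apply he2 hU') (hd x)]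
    congr 1
    refine Filter.EventuallyEq.mfderiv_eq ?_
    filter_upwards [hnear] with y hy
    rw [mvfderiv_comp_map hy (hd y), hUU' y]
  -- The test function is the chart of `N` at `Φ x`, composed with `Φ`. The chart has identity
  -- derivative at its base point, so equality of derivatives is equality of vectors. Nothing
  -- requires `Φ` to be a local diffeomorphism; it will be a projection.
  have h := mvfderiv_mlieBracket (φ := fun y => extChartAt J (Φ x) (Φ y))
    (he2.comp x hΦ2) hV hW
  rw [key hW' hWW', key hV' hVV', hVV', hWW', ← mvfderiv_mlieBracket he2 hV' hW',
    mvfderiv_comp_map hnear.self_of_nhds (hd x)] at h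
  have hinj : ∀ u v : TangentSpace J (Φ x), mvfderiv J (extChartAt J (Φ x)) (Φ x) u
      = mvfderiv J (extChartAt J (Φ x)) (Φ x) v → u = v := by
    intro u v huv
    have e : ∀ w : TangentSpace J (Φ x), mvfderiv J (extChartAt J (Φ x)) (Φ x) w = w := fun w =>
      congrArg (fun A : E' →L[ℝ] E' => A w) (mfderiv_extChartAt_self (I := J) (x := Φ x))
    exact (e u).symm.trans (huv.trans (e v))
  exact hinj _ _ h

end LieBracket

/-! ### Smooth one-forms, smoothness of the anchor, global extensions of pointwise data -/

section SmoothTensors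

variable {E : Type*} [NormedAddCommGroup E] [NormedSpace ℝ E]
  {H : Type*} [TopologicalSpace H] {I : ModelWithCorners ℝ E H}
  {M : Type*} [TopologicalSpace M] [ChartedSpace H M] [IsManifold I ∞ M]
  {E' : Type*} [NormedAddCommGroup E'] [NormedSpace ℝ E']
  {H' : Type*} [TopologicalSpace H'] {J : ModelWithCorners ℝ E' H'}
  {N : Type*} [TopologicalSpace N] [ChartedSpace H' N] [IsManifold J ∞ N]

theorem inCoordinates_covector (x₀ x : M) (α : TangentSpace I x →L[ℝ] Trivial M ℝ x) :
    ContinuousLinearMap.inCoordinates E (TangentSpace I) ℝ (Trivial M ℝ) x₀ x x₀ x α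
      = α.comp ((trivializationAt E (TangentSpace I) x₀).symmL ℝ x) := by
  ext v
  simp [ContinuousLinearMap.inCoordinates]

theorem contMDiffAt_covector_iff {θ : (x : M) → TangentSpace I x →L[ℝ] Trivial M ℝ x} {x₀ : M} :
    ContMDiffAt I (I.prod 𝓘(ℝ, E →L[ℝ] ℝ)) ∞ (fun x => TotalSpace.mk' (E →L[ℝ] ℝ)
      (E := fun x : M => TangentSpace I x →L[ℝ] Trivial M ℝ x) x (θ x)) x₀ ↔
    ContMDiffAt I 𝓘(ℝ, E →L[ℝ] ℝ) ∞ (fun x => (show E →L[ℝ] ℝ from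
      (θ x).comp ((trivializationAt E (TangentSpace I) x₀).symmL ℝ x))) x₀ := by
  rw [contMDiffAt_hom_bundle]
  constructor
  · rintro ⟨-, h⟩
    simpa only [inCoordinates_covector] using h
  · intro h
    refine ⟨contMDiffAt_id, ?_⟩
    simpa only [inCoordinates_covector] using h

/-- The pullback of a one-form under a smooth map. -/
def OneForm.pullback (Φ : C^∞⟮I, M; J, N⟯) (α : OneForm J N) : OneForm I M where
  toFun x := (show CotangentSpace J (Φ x) from α (Φ x)).comp (mfderiv I J Φ x)
  contMDiff_toFun x₀ := by
    rw [contMDiffAt_covector_iff]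
    have h1 := (contMDiffAt_covector_iff.1 (α.contMDiff (Φ x₀))).comp x₀ Φ.contMDiff.contMDiffAt
    have h2 := ContMDiffAt.mfderiv_const (m := ∞) (Φ.contMDiff.contMDiffAt (x := x₀)) (by simp)
    refine (h1.clm_comp h2).congr_of_eventuallyEq ?_
    have hb : ∀ᶠ x in 𝓝 x₀, Φ x ∈ (trivializationAt E' (TangentSpace J) (Φ x₀)).baseSet :=
      Φ.contMDiff.continuous.continuousAt.preimage_mem_nhds
        ((trivializationAt E' (TangentSpace J) (Φ x₀)).open_baseSet.mem_nhds
          (FiberBundle.mem_baseSet_trivializationAt' _))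
    filter_upwards [hb] with x hx
    ext v
    simp only [inTangentCoordinates, ContinuousLinearMap.inCoordinates]
    have h := congrArg (fun w => (show CotangentSpace J (Φ x) from α (Φ x)) w)
      ((trivializationAt E' (TangentSpace J) (Φ x₀)).symmL_continuousLinearMapAt (R := ℝ) hx
        (mfderiv I J Φ x ((trivializationAt E (TangentSpace I) x₀).symmL ℝ x v)))
    exact h.symm

/-- The differential of a smooth function. -/
def OneForm.d (f : C^∞⟮I, M; ℝ⟯) : OneForm I M where
  toFun x := mvfderiv I f x
  contMDiff_toFun x₀ := by
    rw [contMDiffAt_covector_iff]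
    have h2 := ContMDiffAt.mfderiv_const (m := ∞) (f.contMDiff.contMDiffAt (x := x₀)) (by simp)
    refine h2.congr_of_eventuallyEq (Filter.Eventually.of_forall fun x => ?_)
    ext v
    simp only [inTangentCoordinates, ContinuousLinearMap.inCoordinates]
    have hid : (trivializationAt ℝ (TangentSpace 𝓘(ℝ, ℝ)) (f x₀)).continuousLinearMapAt ℝ (f x)
        = ContinuousLinearMap.id ℝ ℝ := TangentBundle.continuousLinearMapAt_model_space _ _
    exact (congrArg (fun A : ℝ →L[ℝ] ℝ => A (mfderiv I 𝓘(ℝ, ℝ) f x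
      ((trivializationAt E (TangentSpace I) x₀).symmL ℝ x v))) hid).symm

/-- The product of a one-form with a smooth function. -/
def OneForm.mulFun (f : C^∞⟮I, M; ℝ⟯) (α : OneForm I M) : OneForm I M where
  toFun x := f x • α x
  contMDiff_toFun := f.contMDiff.smul_section α.contMDiff

theorem OneForm.mulFun_apply (f : C^∞⟮I, M; ℝ⟯) (α : OneForm I M) (x : M) :
    OneForm.mulFun f α x = f x • α x := rfl

omit [IsManifold I ∞ M] in
theorem contMDiffAt_of_section_trivial {s : M → ℝ} {x : M}
    (h : ContMDiffAt I (I.prod 𝓘(ℝ, ℝ)) ∞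
      (fun x => TotalSpace.mk' ℝ (E := Trivial M ℝ) x (s x)) x) :
    ContMDiffAt I 𝓘(ℝ, ℝ) ∞ s x :=
  ((contMDiffAt_section x).1 h)

omit [IsManifold I ∞ M] in
theorem contMDiff_of_section_trivial {s : M → ℝ}
    (h : ContMDiff I (I.prod 𝓘(ℝ, ℝ)) ∞
      (fun x => TotalSpace.mk' ℝ (E := Trivial M ℝ) x (s x))) :
    ContMDiff I 𝓘(ℝ, ℝ) ∞ s :=
  fun x => contMDiffAt_of_section_trivial (h x)

/-- The smooth function `Π (α, β)`. -/
def IsPoissonTensor.pairing {P : ContraTwoTensor I M} (hP : IsPoissonTensor P) (α β : OneForm I M) :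
    C^∞⟮I, M; ℝ⟯ where
  val x := P x (α x) (β x)
  property := by
    have h := (hP.smooth.clm_bundle_apply α.contMDiff).clm_bundle_apply β.contMDiff
    exact contMDiff_of_section_trivial h

/-- The anchor is defined fibre by fibre through the bidual. Its `i`-th coordinate in a local
trivialization is `Π (α, β)`, with `β` the `i`-th coordinate covector of that trivialization, and
this pairing is smooth because `Π`, `α` and `β` are. -/
theorem contMDiff_anchor [FiniteDimensional ℝ E] {P : ContraTwoTensor I M} (hP : IsPoissonTensor P)
    (α : OneForm I M) :
    ContMDiff I I.tangent ∞ (fun x => (anchor P x (α x) : TangentBundle I M)) := by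
  intro x₀
  rw [contMDiffAt_section]
  set e := trivializationAt E (TangentSpace I) x₀ with he
  let b := Module.finBasis ℝ E
  let L : E ≃L[ℝ] (Fin (Module.finrank ℝ E) → ℝ) := b.equivFunL
  suffices h : ContMDiffAt I 𝓘(ℝ, Fin (Module.finrank ℝ E) → ℝ) ∞
      (fun x => L (e ⟨x, anchor P x (α x)⟩).2) x₀ by
    have h2 := (L.symm.contDiff (n := ∞)).contMDiff.contMDiffAt.comp x₀ h
    refine h2.congr_of_eventuallyEq (Filter.Eventually.of_forall fun x => ?_)
    exact (L.symm_apply_apply _).symm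
  rw [contMDiffAt_pi_space]
  intro i
  let ℓ : E →L[ℝ] ℝ := (ContinuousLinearMap.proj (R := ℝ) (φ := fun _ => ℝ) i).comp
    L.toContinuousLinearMap
  let β : (x : M) → TangentSpace I x →L[ℝ] Trivial M ℝ x := fun x =>
    ℓ.comp (e.continuousLinearMapAt ℝ x)
  have hmem : ∀ᶠ x in 𝓝 x₀, x ∈ e.baseSet :=
    e.open_baseSet.mem_nhds (FiberBundle.mem_baseSet_trivializationAt' _)
  have hβ : ContMDiffAt I (I.prod 𝓘(ℝ, E →L[ℝ] ℝ)) ∞ (fun x => TotalSpace.mk' (E →L[ℝ] ℝ)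
      (E := fun x : M => TangentSpace I x →L[ℝ] Trivial M ℝ x) x (β x)) x₀ := by
    rw [contMDiffAt_covector_iff]
    refine (contMDiffAt_const (c := ℓ)).congr_of_eventuallyEq ?_
    filter_upwards [hmem] with x hx
    ext v
    exact congrArg ℓ (e.continuousLinearMapAt_symmL (R := ℝ) hx v)
  have h := contMDiffAt_of_section_trivial
    (((hP.smooth x₀).clm_bundle_apply (α.contMDiff x₀)).clm_bundle_apply hβ)
  refine h.congr_of_eventuallyEq ?_
  filter_upwards [hmem] with x hx
  have h1 : (β x) (anchor P x (α x)) = P x (α x) (β x) := apply_anchor P x (α x) (β x)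
  refine Eq.trans ?_ h1
  exact congrArg ℓ (e.continuousLinearMapAt_apply_of_mem ℝ hx _).symm

/-- `IsFormBracket` tests a form on global smooth vector fields only; this extension makes such
tests determine the form. -/
theorem exists_vectorField_eq [T2Space M] [SecondCountableTopology M] [FiniteDimensional ℝ E]
    (x : M) (v : TangentSpace I x) : ∃ Y : SmoothVectorField I M, Y x = v := by
  obtain ⟨s, hs, hsm⟩ := FiberBundle.exists_contMDiffOn_extend (k := ∞) I E v
  obtain ⟨b, -, hb⟩ := (SmoothBumpFunction.nhds_basis_tsupport (I := I) x).mem_iff.1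
    (interior_mem_nhds.2 hs)
  refine ⟨⟨fun y => b y • FiberBundle.extend E v y, ?_⟩, ?_⟩
  · exact ContMDiffOn.smul_section_of_tsupport b.contMDiff.contMDiffOn isOpen_interior hb
      (hsm.mono interior_subset)
  · change b x • FiberBundle.extend E v x = v
    rw [b.eq_one, one_smul, FiberBundle.extend_apply_self]

/-- A linear function of the chart, cut off by a bump function equal to `1` near `x`. It carries
statements about differentials, such as the Casimir condition, over to arbitrary covectors. -/
theorem exists_mvfderiv_eq [T2Space M] [FiniteDimensional ℝ E]
    (x : M) (α : CotangentSpace I x) : ∃ h : C^∞⟮I, M; ℝ⟯, mvfderiv I h x = α := by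
  obtain ⟨b⟩ : Nonempty (SmoothBumpFunction I x) := inferInstance
  let ℓ : E →L[ℝ] ℝ := α
  have hg : ContMDiffOn I 𝓘(ℝ, ℝ) ∞ (fun y => ℓ (extChartAt I x y)) (chartAt H x).source :=
    ℓ.contDiff.contMDiff.comp_contMDiffOn contMDiffOn_extChartAt
  refine ⟨⟨fun y => b y • ℓ (extChartAt I x y), b.contMDiff_smul hg⟩, ?_⟩
  have h1 : mvfderiv I (fun y => b y • ℓ (extChartAt I x y)) x
      = mvfderiv I (fun y => ℓ (extChartAt I x y)) x := by
    refine Filter.EventuallyEq.mfderiv_eq ?_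
    filter_upwards [b.eventuallyEq_one] with y hy
    rw [hy, Pi.one_apply, one_smul]
  refine h1.trans ?_
  ext v
  rw [mvfderiv_comp_map (J := 𝓘(ℝ, E)) (G := ℓ)
    ℓ.differentiableAt.mdifferentiableAt (mdifferentiableAt_extChartAt (mem_chart_source H x)),
    mfderiv_extChartAt_self]
  have : mvfderiv 𝓘(ℝ, E) ℓ (extChartAt I x x) = ℓ := by
    refine (mfderiv_eq_fderiv).trans ?_
    exact ℓ.fderiv
  exact congrArg (fun A : E →L[ℝ] ℝ => A v) this

end SmoothTensors

section Lifts

variable {E₁ : Type*} [NormedAddCommGroup E₁] [NormedSpace ℝ E₁]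
  {H₁ : Type*} [TopologicalSpace H₁] {I₁ : ModelWithCorners ℝ E₁ H₁}
  {M₁ : Type*} [TopologicalSpace M₁] [ChartedSpace H₁ M₁] [IsManifold I₁ ∞ M₁]
  {E₂ : Type*} [NormedAddCommGroup E₂] [NormedSpace ℝ E₂]
  {H₂ : Type*} [TopologicalSpace H₂] {I₂ : ModelWithCorners ℝ E₂ H₂}
  {M₂ : Type*} [TopologicalSpace M₂] [ChartedSpace H₂ M₂] [IsManifold I₂ ∞ M₂]

/-- The product of a vector field on `M₁` and a vector field on `M₂`. -/
def prodVectorField (Y₁ : SmoothVectorField I₁ M₁) (Y₂ : SmoothVectorField I₂ M₂) :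
    SmoothVectorField (I₁.prod I₂) (M₁ × M₂) where
  toFun x := (Y₁ x.1, Y₂ x.2)
  contMDiff_toFun := by
    have : IsManifold I₁ 1 M₁ := IsManifold.of_le (n := ∞) (by simp)
    have : IsManifold I₂ 1 M₂ := IsManifold.of_le (n := ∞) (by simp)
    exact (contMDiff_equivTangentBundleProd_symm (I := I₁) (I' := I₂)).comp
      ((Y₁.contMDiff.comp contMDiff_fst).prodMk (Y₂.contMDiff.comp contMDiff_snd))

end Lifts

/-! ### Linear algebra of the cometric -/

section Cometric

variable {E : Type*} [NormedAddCommGroup E] [NormedSpace ℝ E] [FiniteDimensional ℝ E]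
  {H : Type*} [TopologicalSpace H] {I : ModelWithCorners ℝ E H}
  {M : Type*} [TopologicalSpace M] [ChartedSpace H M]

/-- A field of symmetric positive definite bilinear forms on the tangent spaces. -/
structure IsInnerField (g : CoTwoTensor I M) : Prop where
  symm : ∀ (x : M) (v w : TangentSpace I x), g x v w = g x w v
  pos : ∀ (x : M) (v : TangentSpace I x), v ≠ 0 → 0 < g x v v

omit [FiniteDimensional ℝ E] in
theorem isInnerField_inner [IsManifold I ∞ M]
    (g : ContMDiffRiemannianMetric I ∞ E (fun x : M => TangentSpace I x)) :
    IsInnerField (I := I) (M := M) g.inner :=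
  ⟨g.symm, g.pos⟩

namespace IsInnerField

variable {g : CoTwoTensor I M} (hg : IsInnerField g)
include hg

theorem isInvertible (x : M) : (g x).IsInvertible := by
  have hinj : Function.Injective (g x).toLinearMap := by
    rw [← LinearMap.ker_eq_bot, LinearMap.ker_eq_bot']
    intro v hv
    by_contra h
    have h1 := hg.pos x v h
    have h2 : g x v = 0 := hv
    rw [h2] at h1
    exact lt_irrefl _ h1
  have hfin : FiniteDimensional ℝ (CotangentSpace I x) :=
    inferInstanceAs (FiniteDimensional ℝ (E →L[ℝ] ℝ))
  have hdim : Module.finrank ℝ (TangentSpace I x) = Module.finrank ℝ (CotangentSpace I x) := by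
    rw [← Subspace.dual_finrank_eq]
    exact (LinearMap.toContinuousLinearMap (𝕜 := ℝ) (E := TangentSpace I x)
      (F' := ℝ)).finrank_eq
  let e : TangentSpace I x ≃L[ℝ] CotangentSpace I x :=
    (LinearEquiv.ofInjectiveOfFinrankEq (g x).toLinearMap hinj hdim).toContinuousLinearEquiv
  exact ⟨e, rfl⟩

theorem apply_sharp (x : M) (α : CotangentSpace I x) : g x (metricSharp g x α) = α :=
  (hg.isInvertible x).self_apply_inverse α

theorem sharp_eq_iff (x : M) (α : CotangentSpace I x) (v : TangentSpace I x) :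
    metricSharp g x α = v ↔ α = g x v :=
  (hg.isInvertible x).inverse_apply_eq

theorem cometric_apply (x : M) (α β : CotangentSpace I x) :
    cometric g x α β = α (metricSharp g x β) := by
  change g x (metricSharp g x α) (metricSharp g x β) = _
  rw [hg.apply_sharp]

omit [FiniteDimensional ℝ E] in
theorem cometric_symm (x : M) (α β : CotangentSpace I x) :
    cometric g x α β = cometric g x β α :=
  hg.symm x _ _

theorem cometric_pos (x : M) (α : CotangentSpace I x) (hα : α ≠ 0) : 0 < cometric g x α α := by
  refine hg.pos x _ fun h => hα ?_
  have h1 : metricSharp g x α = 0 := h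
  rw [← hg.apply_sharp x α, h1, map_zero]

theorem cometric_self_nonneg (x : M) (α : CotangentSpace I x) : 0 ≤ cometric g x α α := by
  by_cases h : α = 0
  · simp [h]
  · exact (hg.cometric_pos x α h).le

theorem eq_zero_of_cometric_self (x : M) (α : CotangentSpace I x) (h : cometric g x α α = 0) :
    α = 0 := by
  by_contra hα
  exact (hg.cometric_pos x α hα).ne' h

theorem gram_pos (x : M) (α β : CotangentSpace I x) (h : LinearIndependent ℝ ![α, β]) :
    0 < cometric g x α α * cometric g x β β - cometric g x α β ^ 2 := by
  rw [LinearIndependent.pair_iff] at h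
  have hβ : β ≠ 0 := fun hβ => by
    have := h 0 1 (by simp [hβ])
    exact one_ne_zero this.2
  have hb := hg.cometric_pos x β hβ
  -- The component of `α` orthogonal to `β`, multiplied by `|β|²`. Its squared norm is `|β|²` times
  -- the Gram determinant.
  have hγ : cometric g x β β • α - cometric g x α β • β ≠ 0 := fun h0 => by
    have := h (cometric g x β β) (- cometric g x α β) (by rw [← h0]; module)
    exact hb.ne' this.1
  have hc := hg.cometric_pos x _ hγ
  simp only [map_sub, map_smul, sub_apply, smul_apply,
    smul_eq_mul, hg.cometric_symm x β α] at hc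
  nlinarith

end IsInnerField

end Cometric

/-! ### The warped metric and bivector in terms of the two factors -/

section WarpedCometric

variable {E₁ : Type*} [NormedAddCommGroup E₁] [NormedSpace ℝ E₁] [FiniteDimensional ℝ E₁]
  {H₁ : Type*} [TopologicalSpace H₁] {I₁ : ModelWithCorners ℝ E₁ H₁}
  {M₁ : Type*} [TopologicalSpace M₁] [ChartedSpace H₁ M₁]
  {E₂ : Type*} [NormedAddCommGroup E₂] [NormedSpace ℝ E₂] [FiniteDimensional ℝ E₂]
  {H₂ : Type*} [TopologicalSpace H₂] {I₂ : ModelWithCorners ℝ E₂ H₂}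
  {M₂ : Type*} [TopologicalSpace M₂] [ChartedSpace H₂ M₂]

/-- The first component of a tangent vector of a product. -/
def tangentFst (x : M₁ × M₂) : TangentSpace (I₁.prod I₂) x →L[ℝ] TangentSpace I₁ x.1 :=
  ContinuousLinearMap.fst ℝ E₁ E₂

/-- The second component of a tangent vector of a product. -/
def tangentSnd (x : M₁ × M₂) : TangentSpace (I₁.prod I₂) x →L[ℝ] TangentSpace I₂ x.2 :=
  ContinuousLinearMap.snd ℝ E₁ E₂

/-- The tangent vector of a product with given components. -/
def tangentMk (x : M₁ × M₂) (u : TangentSpace I₁ x.1) (v : TangentSpace I₂ x.2) :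
    TangentSpace (I₁.prod I₂) x :=
  ((show E₁ from u, show E₂ from v) : E₁ × E₂)

omit [FiniteDimensional ℝ E₁] [FiniteDimensional ℝ E₂] in
@[simp]
theorem tangentFst_mk (x : M₁ × M₂) (u : TangentSpace I₁ x.1) (v : TangentSpace I₂ x.2) :
    tangentFst x (tangentMk x u v) = u := rfl

omit [FiniteDimensional ℝ E₁] [FiniteDimensional ℝ E₂] in
@[simp]
theorem tangentSnd_mk (x : M₁ × M₂) (u : TangentSpace I₁ x.1) (v : TangentSpace I₂ x.2) :
    tangentSnd x (tangentMk x u v) = v := rfl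

omit [FiniteDimensional ℝ E₁] [FiniteDimensional ℝ E₂] in
theorem tangent_ext (x : M₁ × M₂) {v w : TangentSpace (I₁.prod I₂) x}
    (h₁ : tangentFst x v = tangentFst x w) (h₂ : tangentSnd x v = tangentSnd x w) : v = w :=
  Prod.ext h₁ h₂

omit [FiniteDimensional ℝ E₁] [FiniteDimensional ℝ E₂] in
theorem mfderiv_fst_apply (x : M₁ × M₂) (v : TangentSpace (I₁.prod I₂) x) :
    mfderiv (I₁.prod I₂) I₁ Prod.fst x v = tangentFst x v := by
  rw [mfderiv_fst]
  rfl

omit [FiniteDimensional ℝ E₁] [FiniteDimensional ℝ E₂] in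
theorem mfderiv_snd_apply (x : M₁ × M₂) (v : TangentSpace (I₁.prod I₂) x) :
    mfderiv (I₁.prod I₂) I₂ Prod.snd x v = tangentSnd x v := by
  rw [mfderiv_snd]
  rfl

omit [FiniteDimensional ℝ E₁] [FiniteDimensional ℝ E₂] in
theorem restrictFst_apply (x : M₁ × M₂) (α : CotangentSpace (I₁.prod I₂) x)
    (v : TangentSpace I₁ x.1) :
    restrictFst x α v = α (tangentMk x v 0) := by
  change α (mfderiv I₁ (I₁.prod I₂) (fun y : M₁ => (y, x.2)) x.1 v) = _
  rw [mfderiv_prod_left]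
  rfl

omit [FiniteDimensional ℝ E₁] [FiniteDimensional ℝ E₂] in
theorem restrictSnd_apply (x : M₁ × M₂) (α : CotangentSpace (I₁.prod I₂) x)
    (v : TangentSpace I₂ x.2) :
    restrictSnd x α v = α (tangentMk x 0 v) := by
  change α (mfderiv I₂ (I₁.prod I₂) (fun y : M₂ => (x.1, y)) x.2 v) = _
  rw [mfderiv_prod_right]
  rfl

omit [FiniteDimensional ℝ E₁] [FiniteDimensional ℝ E₂] in
theorem covector_apply_eq (x : M₁ × M₂) (α : CotangentSpace (I₁.prod I₂) x)
    (v : TangentSpace (I₁.prod I₂) x) :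
    α v = restrictFst x α (tangentFst x v) + restrictSnd x α (tangentSnd x v) := by
  rw [restrictFst_apply, restrictSnd_apply, ← map_add]
  congr 1
  apply tangent_ext <;> rw [map_add] <;> simp

omit [FiniteDimensional ℝ E₁] [FiniteDimensional ℝ E₂] in
theorem covector_ext (x : M₁ × M₂) {α β : CotangentSpace (I₁.prod I₂) x}
    (h₁ : restrictFst x α = restrictFst x β) (h₂ : restrictSnd x α = restrictSnd x β) : α = β := by
  ext v
  rw [covector_apply_eq, covector_apply_eq x β, h₁, h₂]

omit [FiniteDimensional ℝ E₁] [FiniteDimensional ℝ E₂] in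
theorem warpedMetric_apply (g₁ : CoTwoTensor I₁ M₁) (g₂ : CoTwoTensor I₂ M₂) (f : M₁ → ℝ)
    (x : M₁ × M₂) (v w : TangentSpace (I₁.prod I₂) x) :
    warpedMetric g₁ g₂ f x v w = g₁ x.1 (tangentFst x v) (tangentFst x w)
      + f x.1 ^ 2 * g₂ x.2 (tangentSnd x v) (tangentSnd x w) := by
  change g₁ x.1 (mfderiv (I₁.prod I₂) I₁ Prod.fst x v) (mfderiv (I₁.prod I₂) I₁ Prod.fst x w)
    + f x.1 ^ 2 * g₂ x.2 (mfderiv (I₁.prod I₂) I₂ Prod.snd x v)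
      (mfderiv (I₁.prod I₂) I₂ Prod.snd x w) = _
  simp only [mfderiv_fst_apply, mfderiv_snd_apply]

omit [FiniteDimensional ℝ E₁] [FiniteDimensional ℝ E₂] in
theorem IsInnerField.nonneg {g₁ : CoTwoTensor I₁ M₁} (hg₁ : IsInnerField g₁) (p : M₁)
    (v : TangentSpace I₁ p) : 0 ≤ g₁ p v v := by
  by_cases h : v = 0
  · simp [h]
  · exact (hg₁.pos _ _ h).le

omit [FiniteDimensional ℝ E₁] [FiniteDimensional ℝ E₂] in
theorem isInnerField_warpedMetric {g₁ : CoTwoTensor I₁ M₁} {g₂ : CoTwoTensor I₂ M₂}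
    (hg₁ : IsInnerField g₁) (hg₂ : IsInnerField g₂) {f : M₁ → ℝ} (hf : ∀ p, 0 < f p) :
    IsInnerField (warpedMetric g₁ g₂ f) where
  symm x v w := by
    rw [warpedMetric_apply, warpedMetric_apply, hg₁.symm, hg₂.symm]
  pos x v hv := by
    have hf2 : 0 < f x.1 ^ 2 := pow_pos (hf _) 2
    have n1 := hg₁.nonneg x.1 (tangentFst x v)
    have n2 := hg₂.nonneg x.2 (tangentSnd x v)
    rw [warpedMetric_apply]
    by_cases h : tangentFst x v = 0
    · have h2 : tangentSnd x v ≠ 0 := fun h2 => hv (tangent_ext x (by rw [h, map_zero])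
        (by rw [h2, map_zero]))
      have := hg₂.pos _ _ h2
      positivity
    · have := hg₁.pos _ _ h
      positivity

/-- The factors are orthogonal for the warped metric, so its sharp map splits; inverting the weight
`f²` on the second factor leaves `f⁻²` on covectors. -/
theorem cometric_warpedMetric {g₁ : CoTwoTensor I₁ M₁} {g₂ : CoTwoTensor I₂ M₂}
    (hg₁ : IsInnerField g₁) (hg₂ : IsInnerField g₂) {f : M₁ → ℝ} (hf : ∀ p, 0 < f p)
    (x : M₁ × M₂) (α β : CotangentSpace (I₁.prod I₂) x) :
    cometric (warpedMetric g₁ g₂ f) x α β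
      = cometric g₁ x.1 (restrictFst x α) (restrictFst x β)
        + (f x.1 ^ 2)⁻¹ * cometric g₂ x.2 (restrictSnd x α) (restrictSnd x β) := by
  have hf2 : f x.1 ^ 2 ≠ 0 := (pow_pos (hf _) 2).ne'
  have h : metricSharp (warpedMetric g₁ g₂ f) x β
      = tangentMk x (metricSharp g₁ x.1 (restrictFst x β))
        ((f x.1 ^ 2)⁻¹ • metricSharp g₂ x.2 (restrictSnd x β)) := by
    refine ((isInnerField_warpedMetric hg₁ hg₂ hf).sharp_eq_iff x _ _).2 ?_
    ext w
    rw [warpedMetric_apply, covector_apply_eq, tangentFst_mk, tangentSnd_mk,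
      hg₁.apply_sharp, map_smul, smul_apply, hg₂.apply_sharp, smul_eq_mul,
      mul_inv_cancel_left₀ hf2]
  rw [(isInnerField_warpedMetric hg₁ hg₂ hf).cometric_apply, h, covector_apply_eq,
    hg₁.cometric_apply, hg₂.cometric_apply, tangentFst_mk, tangentSnd_mk, map_smul, smul_eq_mul]

omit [FiniteDimensional ℝ E₁] [FiniteDimensional ℝ E₂] in
theorem warpedBivector_apply (P₁ : ContraTwoTensor I₁ M₁) (P₂ : ContraTwoTensor I₂ M₂)
    (ν : M₁ → ℝ) (x : M₁ × M₂) (α β : CotangentSpace (I₁.prod I₂) x) :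
    warpedBivector P₁ P₂ ν x α β = P₁ x.1 (restrictFst x α) (restrictFst x β)
      + ν x.1 * P₂ x.2 (restrictSnd x α) (restrictSnd x β) := rfl

omit [FiniteDimensional ℝ E₁] in
theorem tangent_eq_of_forall_covector {x : M₁} {u v : TangentSpace I₁ x}
    (h : ∀ β : CotangentSpace I₁ x, β u = β v) : u = v := by
  by_contra hne
  have hne' : (show E₁ from u) - (show E₁ from v) ≠ 0 := sub_ne_zero.2 hne
  obtain ⟨β, hβ⟩ := SeparatingDual.exists_ne_zero (R := ℝ) hne'
  exact hβ ((map_sub β _ _).trans (sub_eq_zero.2 (h β)))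

theorem anchor_warpedBivector (P₁ : ContraTwoTensor I₁ M₁) (P₂ : ContraTwoTensor I₂ M₂)
    (ν : M₁ → ℝ) (x : M₁ × M₂) (α : CotangentSpace (I₁.prod I₂) x) :
    anchor (warpedBivector P₁ P₂ ν) x α
      = tangentMk x (anchor P₁ x.1 (restrictFst x α))
        (ν x.1 • anchor P₂ x.2 (restrictSnd x α)) := by
  refine tangent_eq_of_forall_covector fun β => ?_
  rw [apply_anchor, covector_apply_eq, tangentFst_mk, tangentSnd_mk, map_smul, apply_anchor,
    apply_anchor, warpedBivector_apply, smul_eq_mul]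

end WarpedCometric

/-! ### Derivatives of functions pulled back to the product -/

section ProductCalculus

variable {E₁ : Type*} [NormedAddCommGroup E₁] [NormedSpace ℝ E₁]
  {H₁ : Type*} [TopologicalSpace H₁] {I₁ : ModelWithCorners ℝ E₁ H₁}
  {M₁ : Type*} [TopologicalSpace M₁] [ChartedSpace H₁ M₁]
  {E₂ : Type*} [NormedAddCommGroup E₂] [NormedSpace ℝ E₂]
  {H₂ : Type*} [TopologicalSpace H₂] {I₂ : ModelWithCorners ℝ E₂ H₂}
  {M₂ : Type*} [TopologicalSpace M₂] [ChartedSpace H₂ M₂]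

theorem mdifferentiableAt_comp_fst_iff {h : M₁ → ℝ} {x : M₁ × M₂} :
    MDifferentiableAt (I₁.prod I₂) 𝓘(ℝ, ℝ) (fun y : M₁ × M₂ => h y.1) x ↔
      MDifferentiableAt I₁ 𝓘(ℝ, ℝ) h x.1 :=
  ⟨fun H => H.comp x.1 (f := fun p => (p, x.2))
    (mdifferentiableAt_id.prodMk mdifferentiableAt_const),
    fun H => H.comp x mdifferentiableAt_fst⟩

/-- Differentiability of `h` is not needed: if it fails, it fails for the pullback as well (restrict
to a slice), and both derivatives take the default value `0`. This matters because `IsInnerField`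
retains no smoothness of the metric, so functions such as `g̃₁(β, γ)` are differentiated without
knowing that they are differentiable. -/
theorem mvfderiv_comp_fst (h : M₁ → ℝ) (x : M₁ × M₂) (v : TangentSpace (I₁.prod I₂) x) :
    mvfderiv (I₁.prod I₂) (fun y : M₁ × M₂ => h y.1) x v = mvfderiv I₁ h x.1 (tangentFst x v) := by
  by_cases hd : MDifferentiableAt I₁ 𝓘(ℝ, ℝ) h x.1
  · rw [mvfderiv_comp_map hd mdifferentiableAt_fst, mfderiv_fst_apply]
  · have h1 : mfderiv I₁ 𝓘(ℝ, ℝ) h x.1 = 0 := mfderiv_zero_of_not_mdifferentiableAt hd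
    have h2 : mfderiv (I₁.prod I₂) 𝓘(ℝ, ℝ) (fun y : M₁ × M₂ => h y.1) x = 0 :=
      mfderiv_zero_of_not_mdifferentiableAt (fun H => hd (mdifferentiableAt_comp_fst_iff.1 H))
    unfold mvfderiv
    rw [h1, h2]
    rfl

theorem mdifferentiableAt_comp_snd_iff {h : M₂ → ℝ} {x : M₁ × M₂} :
    MDifferentiableAt (I₁.prod I₂) 𝓘(ℝ, ℝ) (fun y : M₁ × M₂ => h y.2) x ↔
      MDifferentiableAt I₂ 𝓘(ℝ, ℝ) h x.2 :=
  ⟨fun H => H.comp x.2 (f := fun p => (x.1, p))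
    (mdifferentiableAt_const.prodMk mdifferentiableAt_id),
    fun H => H.comp x mdifferentiableAt_snd⟩

theorem mvfderiv_comp_snd (h : M₂ → ℝ) (x : M₁ × M₂) (v : TangentSpace (I₁.prod I₂) x) :
    mvfderiv (I₁.prod I₂) (fun y : M₁ × M₂ => h y.2) x v = mvfderiv I₂ h x.2 (tangentSnd x v) := by
  by_cases hd : MDifferentiableAt I₂ 𝓘(ℝ, ℝ) h x.2
  · rw [mvfderiv_comp_map hd mdifferentiableAt_snd, mfderiv_snd_apply]
  · have h1 : mfderiv I₂ 𝓘(ℝ, ℝ) h x.2 = 0 := mfderiv_zero_of_not_mdifferentiableAt hd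
    have h2 : mfderiv (I₁.prod I₂) 𝓘(ℝ, ℝ) (fun y : M₁ × M₂ => h y.2) x = 0 :=
      mfderiv_zero_of_not_mdifferentiableAt (fun H => hd (mdifferentiableAt_comp_snd_iff.1 H))
    unfold mvfderiv
    rw [h1, h2]
    rfl

theorem mvfderiv_mul_prod {k : M₁ → ℝ} {h : M₂ → ℝ} {x : M₁ × M₂}
    (hk : MDifferentiableAt I₁ 𝓘(ℝ, ℝ) k x.1) (hh : MDifferentiableAt I₂ 𝓘(ℝ, ℝ) h x.2)
    (v : TangentSpace (I₁.prod I₂) x) :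
    mvfderiv (I₁.prod I₂) (fun y : M₁ × M₂ => k y.1 * h y.2) x v
      = k x.1 * mvfderiv I₂ h x.2 (tangentSnd x v)
        + mvfderiv I₁ k x.1 (tangentFst x v) * h x.2 := by
  have e := mvfderiv_mul (I := I₁.prod I₂) (x := x)
    (f := fun y : M₁ × M₂ => k y.1) (g := fun y : M₁ × M₂ => h y.2)
    (mdifferentiableAt_comp_fst_iff.2 hk) (mdifferentiableAt_comp_snd_iff.2 hh)
  have e2 := congrArg (fun A => A v) e
  refine e2.trans ?_
  simp only [add_apply, smul_apply, mvfderiv_comp_fst, mvfderiv_comp_snd, smul_eq_mul]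
  ring

/-- Again `h` may fail to be differentiable. Since `k x.1 ≠ 0`, `h` is recovered from the
restriction of the product to a slice, so the product is then not differentiable either and both
sides are `0`. It is used with `k = f⁻²`. -/
theorem mvfderiv_mul_prod_of_eq_zero {k : M₁ → ℝ} {h : M₂ → ℝ} {x : M₁ × M₂}
    (hk : MDifferentiableAt I₁ 𝓘(ℝ, ℝ) k x.1) (hk0 : k x.1 ≠ 0)
    (v : TangentSpace (I₁.prod I₂) x) (hv : mvfderiv I₁ k x.1 (tangentFst x v) = 0) :
    mvfderiv (I₁.prod I₂) (fun y : M₁ × M₂ => k y.1 * h y.2) x v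
      = k x.1 * mvfderiv I₂ h x.2 (tangentSnd x v) := by
  by_cases hd : MDifferentiableAt I₂ 𝓘(ℝ, ℝ) h x.2
  · rw [mvfderiv_mul_prod hk hd, hv, zero_mul, add_zero]
  · have h1 : mfderiv I₂ 𝓘(ℝ, ℝ) h x.2 = 0 := mfderiv_zero_of_not_mdifferentiableAt hd
    have h2 : mfderiv (I₁.prod I₂) 𝓘(ℝ, ℝ) (fun y : M₁ × M₂ => k y.1 * h y.2) x = 0 := by
      refine mfderiv_zero_of_not_mdifferentiableAt (fun H => hd ?_)
      have H2 := H.comp x.2 (f := fun q => (x.1, q))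
        (mdifferentiableAt_const.prodMk mdifferentiableAt_id)
      have H3 : MDifferentiableAt I₂ 𝓘(ℝ, ℝ) (fun q => (k x.1)⁻¹ * (k x.1 * h q)) x.2 :=
        (mdifferentiableAt_const (c := (k x.1)⁻¹)).mul H2
      simpa only [inv_mul_cancel_left₀ hk0] using H3
    unfold mvfderiv
    rw [h1, h2]
    change (0 : ℝ) = k x.1 * 0
    rw [mul_zero]

end ProductCalculus

/-! ### Lifting one-forms to the product and restricting them to slices -/

section LiftedForms

variable {E₁ : Type*} [NormedAddCommGroup E₁] [NormedSpace ℝ E₁]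
  {H₁ : Type*} [TopologicalSpace H₁] {I₁ : ModelWithCorners ℝ E₁ H₁}
  {M₁ : Type*} [TopologicalSpace M₁] [ChartedSpace H₁ M₁] [IsManifold I₁ ∞ M₁]
  {E₂ : Type*} [NormedAddCommGroup E₂] [NormedSpace ℝ E₂]
  {H₂ : Type*} [TopologicalSpace H₂] {I₂ : ModelWithCorners ℝ E₂ H₂}
  {M₂ : Type*} [TopologicalSpace M₂] [ChartedSpace H₂ M₂] [IsManifold I₂ ∞ M₂]

namespace OneForm

variable (I₂ M₂) in
/-- The lift to the product of a one-form on the first factor. -/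
def liftFst (α : OneForm I₁ M₁) : OneForm (I₁.prod I₂) (M₁ × M₂) :=
  OneForm.pullback ContMDiffMap.fst α

variable (I₁ M₁) in
/-- The lift to the product of a one-form on the second factor. -/
def liftSnd (α : OneForm I₂ M₂) : OneForm (I₁.prod I₂) (M₁ × M₂) :=
  OneForm.pullback ContMDiffMap.snd α

/-- The restriction of a one-form on the product to the slice `M₁ × {q}`. -/
def sliceFst (q : M₂) (θ : OneForm (I₁.prod I₂) (M₁ × M₂)) : OneForm I₁ M₁ :=
  OneForm.pullback ⟨fun p => (p, q), contMDiff_id.prodMk contMDiff_const⟩ θ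

/-- The restriction of a one-form on the product to the slice `{p} × M₂`. -/
def sliceSnd (p : M₁) (θ : OneForm (I₁.prod I₂) (M₁ × M₂)) : OneForm I₂ M₂ :=
  OneForm.pullback ⟨fun q => (p, q), contMDiff_const.prodMk contMDiff_id⟩ θ

theorem liftFst_apply (α : OneForm I₁ M₁) (x : M₁ × M₂) (v : TangentSpace (I₁.prod I₂) x) :
    liftFst I₂ M₂ α x v = α x.1 (tangentFst x v) := by
  rw [← mfderiv_fst_apply]
  rfl

theorem liftSnd_apply (α : OneForm I₂ M₂) (x : M₁ × M₂) (v : TangentSpace (I₁.prod I₂) x) :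
    liftSnd I₁ M₁ α x v = α x.2 (tangentSnd x v) := by
  rw [← mfderiv_snd_apply]
  rfl

theorem sliceFst_apply (q : M₂) (θ : OneForm (I₁.prod I₂) (M₁ × M₂)) (p : M₁) :
    sliceFst q θ p = restrictFst (p, q) (θ (p, q)) := rfl

theorem sliceSnd_apply (p : M₁) (θ : OneForm (I₁.prod I₂) (M₁ × M₂)) (q : M₂) :
    sliceSnd p θ q = restrictSnd (p, q) (θ (p, q)) := rfl

@[simp]
theorem restrictFst_liftFst (α : OneForm I₁ M₁) (x : M₁ × M₂) :
    restrictFst x (liftFst I₂ M₂ α x) = α x.1 := by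
  ext v
  rw [restrictFst_apply]
  exact (liftFst_apply α x _).trans (by rw [tangentFst_mk])

@[simp]
theorem restrictSnd_liftFst (α : OneForm I₁ M₁) (x : M₁ × M₂) :
    restrictSnd x (liftFst I₂ M₂ α x) = 0 := by
  ext v
  rw [restrictSnd_apply]
  refine (liftFst_apply α x _).trans ?_
  rw [tangentFst_mk, map_zero]
  rfl

@[simp]
theorem restrictFst_liftSnd (α : OneForm I₂ M₂) (x : M₁ × M₂) :
    restrictFst x (liftSnd I₁ M₁ α x) = 0 := by
  ext v
  rw [restrictFst_apply]
  refine (liftSnd_apply α x _).trans ?_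
  rw [tangentSnd_mk, map_zero]
  rfl

@[simp]
theorem restrictSnd_liftSnd (α : OneForm I₂ M₂) (x : M₁ × M₂) :
    restrictSnd x (liftSnd I₁ M₁ α x) = α x.2 := by
  ext v
  rw [restrictSnd_apply]
  exact (liftSnd_apply α x _).trans (by rw [tangentSnd_mk])

end OneForm

end LiftedForms

/-! ### The bracket of lifted forms, evaluated on vector fields -/

section BracketOfLifts

variable {E : Type*} [NormedAddCommGroup E] [NormedSpace ℝ E] [FiniteDimensional ℝ E]
  {H : Type*} [TopologicalSpace H] {I : ModelWithCorners ℝ E H}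
  {M : Type*} [TopologicalSpace M] [ChartedSpace H M] [IsManifold I ∞ M]

/-- The value of `[α, β]_Π` on a vector field. -/
def bracketApply (P : ContraTwoTensor I M) (α β : OneForm I M) (Y : SmoothVectorField I M)
    (x : M) : ℝ :=
  lieDerivativeApply (fun y => anchor P y (α y)) β Y x
    - lieDerivativeApply (fun y => anchor P y (β y)) α Y x
    - mvfderiv I (fun y => P y (α y) (β y)) x (Y x)

theorem OneForm.ext_of_vectorField [T2Space M] [SecondCountableTopology M] {θ θ' : OneForm I M}
    (h : ∀ (Y : SmoothVectorField I M) (x : M), θ x (Y x) = θ' x (Y x)) : θ = θ' := by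
  ext x : 1
  ext v
  obtain ⟨Y, rfl⟩ := exists_vectorField_eq x v
  exact h Y x

theorem IsFormBracket.unique [T2Space M] [SecondCountableTopology M] {P : ContraTwoTensor I M}
    {α β θ θ' : OneForm I M} (h : IsFormBracket P α β θ) (h' : IsFormBracket P α β θ') : θ = θ' :=
  OneForm.ext_of_vectorField fun Y x => (h Y x).trans (h' Y x).symm

/-- The smooth vector field `♯_Π α`. -/
def anchorField {P : ContraTwoTensor I M} (hP : IsPoissonTensor P) (α : OneForm I M) :
    SmoothVectorField I M := ⟨fun x => anchor P x (α x), contMDiff_anchor hP α⟩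

omit [IsManifold I ∞ M] in
theorem anchor_zero (P : ContraTwoTensor I M) (x : M) : anchor P x 0 = 0 := by
  refine tangent_eq_of_forall_covector fun β => ?_
  rw [apply_anchor]
  simp

omit [FiniteDimensional ℝ E] in
theorem SmoothVectorField.mdifferentiableAt (Y : SmoothVectorField I M) (x : M) :
    MDifferentiableAt I I.tangent (fun y => (Y y : TangentBundle I M)) x :=
  (Y.contMDiff x).mdifferentiableAt (by simp)

end BracketOfLifts

section BracketOnProduct

variable {E₁ : Type*} [NormedAddCommGroup E₁] [NormedSpace ℝ E₁] [FiniteDimensional ℝ E₁]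
  {H₁ : Type*} [TopologicalSpace H₁] {I₁ : ModelWithCorners ℝ E₁ H₁}
  {M₁ : Type*} [TopologicalSpace M₁] [ChartedSpace H₁ M₁] [IsManifold I₁ ∞ M₁]
  {E₂ : Type*} [NormedAddCommGroup E₂] [NormedSpace ℝ E₂] [FiniteDimensional ℝ E₂]
  {H₂ : Type*} [TopologicalSpace H₂] {I₂ : ModelWithCorners ℝ E₂ H₂}
  {M₂ : Type*} [TopologicalSpace M₂] [ChartedSpace H₂ M₂] [IsManifold I₂ ∞ M₂]

open OneForm

/-- Both fields are related by the projection to fields on `M₁`, hence so is their bracket. The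
second components are unrestricted, which admits fields rescaled by `ν` as long as the first
component is `0`. -/
theorem lieDerivativeApply_liftFst {X Y : (x : M₁ × M₂) → TangentSpace (I₁.prod I₂) x}
    {X₁ Y₁ : SmoothVectorField I₁ M₁} (β : OneForm I₁ M₁) {x : M₁ × M₂}
    (hX : MDifferentiableAt (I₁.prod I₂) (I₁.prod I₂).tangent
      (fun y => (X y : TangentBundle (I₁.prod I₂) (M₁ × M₂))) x)
    (hY : MDifferentiableAt (I₁.prod I₂) (I₁.prod I₂).tangent
      (fun y => (Y y : TangentBundle (I₁.prod I₂) (M₁ × M₂))) x)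
    (hXX₁ : ∀ y, tangentFst y (X y) = X₁ y.1) (hYY₁ : ∀ y, tangentFst y (Y y) = Y₁ y.1) :
    lieDerivativeApply X (liftFst I₂ M₂ β) Y x = lieDerivativeApply X₁ β Y₁ x.1 := by
  have h1 : (fun y => liftFst I₂ M₂ β y (Y y)) = fun y => β y.1 (Y₁ y.1) := by
    funext y
    rw [liftFst_apply, hYY₁]
  have h2 : tangentFst x (mlieBracket (I₁.prod I₂) X Y x) = mlieBracket I₁ X₁ Y₁ x.1 := by
    rw [← mfderiv_fst_apply]
    exact mfderiv_mlieBracket_of_related contMDiff_fst hX hY (X₁.mdifferentiableAt _)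
      (Y₁.mdifferentiableAt _) (fun y => (mfderiv_fst_apply y _).trans (hXX₁ y))
      (fun y => (mfderiv_fst_apply y _).trans (hYY₁ y))
  unfold lieDerivativeApply
  rw [h1, liftFst_apply, h2]
  congr 1
  refine (mvfderiv_comp_fst (fun p => β p (Y₁ p)) x (X x)).trans ?_
  rw [hXX₁]

theorem lieDerivativeApply_liftSnd {X Y : (x : M₁ × M₂) → TangentSpace (I₁.prod I₂) x}
    {X₂ Y₂ : SmoothVectorField I₂ M₂} (β : OneForm I₂ M₂) {x : M₁ × M₂}
    (hX : MDifferentiableAt (I₁.prod I₂) (I₁.prod I₂).tangent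
      (fun y => (X y : TangentBundle (I₁.prod I₂) (M₁ × M₂))) x)
    (hY : MDifferentiableAt (I₁.prod I₂) (I₁.prod I₂).tangent
      (fun y => (Y y : TangentBundle (I₁.prod I₂) (M₁ × M₂))) x)
    (hXX₂ : ∀ y, tangentSnd y (X y) = X₂ y.2) (hYY₂ : ∀ y, tangentSnd y (Y y) = Y₂ y.2) :
    lieDerivativeApply X (liftSnd I₁ M₁ β) Y x = lieDerivativeApply X₂ β Y₂ x.2 := by
  have h1 : (fun y => liftSnd I₁ M₁ β y (Y y)) = fun y => β y.2 (Y₂ y.2) := by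
    funext y
    rw [liftSnd_apply, hYY₂]
  have h2 : tangentSnd x (mlieBracket (I₁.prod I₂) X Y x) = mlieBracket I₂ X₂ Y₂ x.2 := by
    rw [← mfderiv_snd_apply]
    exact mfderiv_mlieBracket_of_related contMDiff_snd hX hY (X₂.mdifferentiableAt _)
      (Y₂.mdifferentiableAt _) (fun y => (mfderiv_snd_apply y _).trans (hXX₂ y))
      (fun y => (mfderiv_snd_apply y _).trans (hYY₂ y))
  unfold lieDerivativeApply
  rw [h1, liftSnd_apply, h2]
  congr 1
  refine (mvfderiv_comp_snd (fun p => β p (Y₂ p)) x (X x)).trans ?_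
  rw [hXX₂]

theorem lieDerivativeApply_zero_left {E : Type*} [NormedAddCommGroup E] [NormedSpace ℝ E]
    {H : Type*} [TopologicalSpace H] {I : ModelWithCorners ℝ E H}
    {M : Type*} [TopologicalSpace M] [ChartedSpace H M]
    (β : (x : M) → CotangentSpace I x) (Y : (x : M) → TangentSpace I x) (x : M) :
    lieDerivativeApply 0 β Y x = 0 := by
  unfold lieDerivativeApply
  rw [mlieBracket_zero_left]
  simp

/-- With `k = ν` the extra term is the source of `dν` in the bracket of two vertical forms. -/
theorem lieDerivativeApply_smul {E : Type*} [NormedAddCommGroup E] [NormedSpace ℝ E]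
    [CompleteSpace E] {H : Type*} [TopologicalSpace H] {I : ModelWithCorners ℝ E H}
    {M : Type*} [TopologicalSpace M] [ChartedSpace H M] [IsManifold I ∞ M]
    {k : M → ℝ} {X : SmoothVectorField I M} (β : (x : M) → CotangentSpace I x)
    (Y : (x : M) → TangentSpace I x) {x : M} (hk : MDifferentiableAt I 𝓘(ℝ, ℝ) k x) :
    lieDerivativeApply (fun y => k y • X y) β Y x
      = k x * lieDerivativeApply X β Y x + mvfderiv I k x (Y x) * β x (X x) := by
  have : IsManifold I 2 M := IsManifold.of_le (n := ∞) ENat.LEInfty.out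
  unfold lieDerivativeApply
  have h := mlieBracket_smul_left (W := Y) hk (X.mdifferentiableAt x)
  have h' : mlieBracket I (fun y => k y • X y) Y x
    = - mvfderiv I k x (Y x) • X x + k x • mlieBracket I X Y x := h
  rw [h', map_smul, map_add, map_smul, map_smul]
  simp only [smul_eq_mul]
  ring

omit [FiniteDimensional ℝ E₁] [FiniteDimensional ℝ E₂] in
theorem tangentFst_prodVectorField (Y₁ : SmoothVectorField I₁ M₁) (Y₂ : SmoothVectorField I₂ M₂)
    (x : M₁ × M₂) : tangentFst x (prodVectorField Y₁ Y₂ x) = Y₁ x.1 := rfl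

omit [FiniteDimensional ℝ E₁] [FiniteDimensional ℝ E₂] in
theorem tangentSnd_prodVectorField (Y₁ : SmoothVectorField I₁ M₁) (Y₂ : SmoothVectorField I₂ M₂)
    (x : M₁ × M₂) : tangentSnd x (prodVectorField Y₁ Y₂ x) = Y₂ x.2 := rfl

variable {P₁ : ContraTwoTensor I₁ M₁} (hP₁ : IsPoissonTensor P₁)
  {P₂ : ContraTwoTensor I₂ M₂} (hP₂ : IsPoissonTensor P₂) (ν : C^∞⟮I₁, M₁; ℝ⟯)

include hP₁ in
theorem anchor_liftFst (α : OneForm I₁ M₁) :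
    (fun y => anchor (warpedBivector P₁ P₂ ν) y (liftFst I₂ M₂ α y))
      = prodVectorField (anchorField hP₁ α) 0 := by
  funext y
  rw [anchor_warpedBivector, restrictFst_liftFst, restrictSnd_liftFst, anchor_zero, smul_zero]
  rfl

include hP₂ in
theorem anchor_liftSnd (α : OneForm I₂ M₂) :
    (fun y => anchor (warpedBivector P₁ P₂ ν) y (liftSnd I₁ M₁ α y))
      = fun y => ν y.1 • prodVectorField 0 (anchorField hP₂ α) y := by
  funext y
  rw [anchor_warpedBivector, restrictFst_liftSnd, restrictSnd_liftSnd, anchor_zero]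
  refine tangent_ext y ?_ ?_
  · rw [map_smul, tangentFst_prodVectorField, tangentFst_mk]
    exact (smul_zero _).symm
  · rw [map_smul, tangentSnd_prodVectorField, tangentSnd_mk]
    rfl

include hP₁ in
theorem bracketApply_liftFst_liftFst (α β : OneForm I₁ M₁) (Y₁ : SmoothVectorField I₁ M₁)
    (Y₂ : SmoothVectorField I₂ M₂) (x : M₁ × M₂) :
    bracketApply (warpedBivector P₁ P₂ ν) (liftFst I₂ M₂ α) (liftFst I₂ M₂ β)
      (prodVectorField Y₁ Y₂) x = bracketApply P₁ α β Y₁ x.1 := by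
  unfold bracketApply
  rw [anchor_liftFst hP₁, anchor_liftFst hP₁,
    lieDerivativeApply_liftFst (X₁ := anchorField hP₁ α) (Y₁ := Y₁) β
      (SmoothVectorField.mdifferentiableAt _ x) (SmoothVectorField.mdifferentiableAt _ x)
      (tangentFst_prodVectorField _ _) (tangentFst_prodVectorField _ _),
    lieDerivativeApply_liftFst (X₁ := anchorField hP₁ β) (Y₁ := Y₁) α
      (SmoothVectorField.mdifferentiableAt _ x) (SmoothVectorField.mdifferentiableAt _ x)
      (tangentFst_prodVectorField _ _) (tangentFst_prodVectorField _ _)]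
  have h : (fun y : M₁ × M₂ => warpedBivector P₁ P₂ ν y (liftFst I₂ M₂ α y) (liftFst I₂ M₂ β y))
      = fun y => P₁ y.1 (α y.1) (β y.1) := by
    funext y
    rw [warpedBivector_apply]
    simp
  rw [h]
  congr 1
  exact mvfderiv_comp_fst (fun p => P₁ p (α p) (β p)) x _

omit [FiniteDimensional ℝ E₁] [FiniteDimensional ℝ E₂] in
theorem mdifferentiableAt_smul_prodVectorField (Y₁ : SmoothVectorField I₁ M₁)
    (Y₂ : SmoothVectorField I₂ M₂) (x : M₁ × M₂) :
    MDifferentiableAt (I₁.prod I₂) (I₁.prod I₂).tangent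
      (fun y => ((ν y.1 • prodVectorField Y₁ Y₂ y : TangentSpace (I₁.prod I₂) y) :
        TangentBundle (I₁.prod I₂) (M₁ × M₂))) x :=
  (((ν.contMDiff.comp contMDiff_fst).smul_section
    (prodVectorField Y₁ Y₂).contMDiff) x).mdifferentiableAt (by simp)

include hP₁ hP₂ in
-- The anchor of a horizontal form has no second component and that of a vertical form has no first
-- component, even after multiplication by `ν`. Both Lie derivatives are therefore taken along a
-- field projecting to `0`, and the pairing of the two forms vanishes.
theorem bracketApply_liftFst_liftSnd (α : OneForm I₁ M₁) (β : OneForm I₂ M₂)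
    (Y₁ : SmoothVectorField I₁ M₁) (Y₂ : SmoothVectorField I₂ M₂) (x : M₁ × M₂) :
    bracketApply (warpedBivector P₁ P₂ ν) (liftFst I₂ M₂ α) (liftSnd I₁ M₁ β)
      (prodVectorField Y₁ Y₂) x = 0 := by
  unfold bracketApply
  rw [anchor_liftFst hP₁, anchor_liftSnd hP₂,
    lieDerivativeApply_liftSnd (X₂ := 0) (Y₂ := Y₂) β
      (SmoothVectorField.mdifferentiableAt _ x) (SmoothVectorField.mdifferentiableAt _ x)
      (tangentSnd_prodVectorField _ _) (tangentSnd_prodVectorField _ _),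
    lieDerivativeApply_liftFst (X₁ := 0) (Y₁ := Y₁) α
      (mdifferentiableAt_smul_prodVectorField ν _ _ x) (SmoothVectorField.mdifferentiableAt _ x)
      (fun y => by rw [map_smul, tangentFst_prodVectorField]; exact smul_zero _)
      (tangentFst_prodVectorField _ _)]
  have h : (fun y : M₁ × M₂ => warpedBivector P₁ P₂ ν y (liftFst I₂ M₂ α y) (liftSnd I₁ M₁ β y))
      = fun y => 0 := by
    funext y
    rw [warpedBivector_apply]
    simp
  rw [h, mvfderiv_const]
  have z1 := lieDerivativeApply_zero_left (I := I₁) (fun p => (α p : CotangentSpace I₁ p)) Y₁ x.1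
  have z2 := lieDerivativeApply_zero_left (I := I₂) (fun p => (β p : CotangentSpace I₂ p)) Y₂ x.2
  refine (congrArg₂ (fun a b : ℝ => a - b - 0) z2 z1).trans ?_
  norm_num

include hP₂ in
-- The two Lie derivatives along `ν ♯₂α` and `ν ♯₂β` contribute `Π₂(α, β) dν` each, by skewness, and
-- `-d(ν Π₂(α, β))` takes one of them back. Exactly one copy survives.
theorem bracketApply_liftSnd_liftSnd (α β : OneForm I₂ M₂) (Y₁ : SmoothVectorField I₁ M₁)
    (Y₂ : SmoothVectorField I₂ M₂) (x : M₁ × M₂) :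
    bracketApply (warpedBivector P₁ P₂ ν) (liftSnd I₁ M₁ α) (liftSnd I₁ M₁ β)
      (prodVectorField Y₁ Y₂) x = ν x.1 * bracketApply P₂ α β Y₂ x.2
        + P₂ x.2 (α x.2) (β x.2) * mvfderiv I₁ ν x.1 (Y₁ x.1) := by
  have hν : MDifferentiableAt I₁ 𝓘(ℝ, ℝ) ν x.1 := (ν.contMDiff _).mdifferentiableAt (by simp)
  have hL : ∀ γ δ : OneForm I₂ M₂,
      lieDerivativeApply (fun y : M₁ × M₂ => ν y.1 • prodVectorField 0 (anchorField hP₂ γ) y)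
        (liftSnd I₁ M₁ δ) (prodVectorField Y₁ Y₂) x
      = ν x.1 * lieDerivativeApply (anchorField hP₂ γ) δ Y₂ x.2
        + mvfderiv I₁ ν x.1 (Y₁ x.1) * P₂ x.2 (γ x.2) (δ x.2) := by
    intro γ δ
    have h1 := lieDerivativeApply_smul (k := fun y : M₁ × M₂ => ν y.1)
      (X := prodVectorField 0 (anchorField hP₂ γ))
      (fun y => (liftSnd I₁ M₁ δ y : CotangentSpace (I₁.prod I₂) y)) (prodVectorField Y₁ Y₂)
      (x := x) (mdifferentiableAt_comp_fst_iff.2 hν)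
    refine h1.trans ?_
    rw [mvfderiv_comp_fst, tangentFst_prodVectorField, liftSnd_apply, tangentSnd_prodVectorField,
      lieDerivativeApply_liftSnd (X₂ := anchorField hP₂ γ) (Y₂ := Y₂) δ
      (SmoothVectorField.mdifferentiableAt _ x) (SmoothVectorField.mdifferentiableAt _ x)
      (tangentSnd_prodVectorField _ _) (tangentSnd_prodVectorField _ _)]
    congr 2
    exact apply_anchor P₂ x.2 (γ x.2) (δ x.2)
  have h : (fun y : M₁ × M₂ => warpedBivector P₁ P₂ ν y (liftSnd I₁ M₁ α y) (liftSnd I₁ M₁ β y))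
      = fun y => ν y.1 * P₂ y.2 (α y.2) (β y.2) := by
    funext y
    rw [warpedBivector_apply]
    simp
  have hd : MDifferentiableAt I₂ 𝓘(ℝ, ℝ) (fun q => P₂ q (α q) (β q)) x.2 :=
    ((hP₂.pairing α β).contMDiff _).mdifferentiableAt (by simp)
  unfold bracketApply
  rw [anchor_liftSnd hP₂, anchor_liftSnd hP₂, hL, hL, h, mvfderiv_mul_prod hν hd,
    tangentFst_prodVectorField, tangentSnd_prodVectorField, hP₂.skew x.2 (β x.2) (α x.2)]
  change _ = ν x.1 * (lieDerivativeApply (anchorField hP₂ α) β Y₂ x.2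
    - lieDerivativeApply (anchorField hP₂ β) α Y₂ x.2 - _) + _
  ring

end BracketOnProduct

/-! ### Brackets of lifted forms as one-forms -/

section FormBracketOnProduct

variable {E₁ : Type*} [NormedAddCommGroup E₁] [NormedSpace ℝ E₁] [FiniteDimensional ℝ E₁]
  {H₁ : Type*} [TopologicalSpace H₁] {I₁ : ModelWithCorners ℝ E₁ H₁}
  {M₁ : Type*} [TopologicalSpace M₁] [ChartedSpace H₁ M₁] [IsManifold I₁ ∞ M₁]
  [T2Space M₁] [SecondCountableTopology M₁]
  {E₂ : Type*} [NormedAddCommGroup E₂] [NormedSpace ℝ E₂] [FiniteDimensional ℝ E₂]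
  {H₂ : Type*} [TopologicalSpace H₂] {I₂ : ModelWithCorners ℝ E₂ H₂}
  {M₂ : Type*} [TopologicalSpace M₂] [ChartedSpace H₂ M₂] [IsManifold I₂ ∞ M₂]
  [T2Space M₂] [SecondCountableTopology M₂]

open OneForm

namespace OneForm

theorem ext_of_prodVectorField {θ θ' : OneForm (I₁.prod I₂) (M₁ × M₂)}
    (h : ∀ (Y₁ : SmoothVectorField I₁ M₁) (Y₂ : SmoothVectorField I₂ M₂) (x : M₁ × M₂),
      θ x (prodVectorField Y₁ Y₂ x) = θ' x (prodVectorField Y₁ Y₂ x)) : θ = θ' := by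
  ext x : 1
  ext v
  obtain ⟨Y₁, h₁⟩ := exists_vectorField_eq x.1 (tangentFst x v)
  obtain ⟨Y₂, h₂⟩ := exists_vectorField_eq x.2 (tangentSnd x v)
  have hv : v = prodVectorField Y₁ Y₂ x := tangent_ext x h₁.symm h₂.symm
  rw [hv]
  exact h Y₁ Y₂ x

omit [FiniteDimensional ℝ E₁] [FiniteDimensional ℝ E₂] [T2Space M₁] [T2Space M₂]
  [SecondCountableTopology M₁] [SecondCountableTopology M₂]

theorem add_apply' (α β : OneForm I₁ M₁) (x : M₁) : (α + β) x = α x + β x := rfl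

theorem sub_apply' (α β : OneForm I₁ M₁) (x : M₁) : (α - β) x = α x - β x := rfl

theorem smul_apply' (c : ℝ) (α : OneForm I₁ M₁) (x : M₁) : (c • α) x = c • α x := rfl

theorem liftFst_add (α β : OneForm I₁ M₁) :
    liftFst I₂ M₂ (α + β) = liftFst I₂ M₂ α + liftFst I₂ M₂ β := by
  ext x : 1
  rfl

theorem liftFst_sub (α β : OneForm I₁ M₁) :
    liftFst I₂ M₂ (α - β) = liftFst I₂ M₂ α - liftFst I₂ M₂ β := by
  ext x : 1
  rfl

theorem liftSnd_add (α β : OneForm I₂ M₂) :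
    liftSnd I₁ M₁ (α + β) = liftSnd I₁ M₁ α + liftSnd I₁ M₁ β := by
  ext x : 1
  rfl

theorem sliceFst_add (q : M₂) (θ θ' : OneForm (I₁.prod I₂) (M₁ × M₂)) :
    sliceFst q (θ + θ') = sliceFst q θ + sliceFst q θ' := by
  ext x : 1
  rfl

theorem sliceFst_sub (q : M₂) (θ θ' : OneForm (I₁.prod I₂) (M₁ × M₂)) :
    sliceFst q (θ - θ') = sliceFst q θ - sliceFst q θ' := by
  ext x : 1
  rfl

theorem sliceSnd_add (p : M₁) (θ θ' : OneForm (I₁.prod I₂) (M₁ × M₂)) :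
    sliceSnd p (θ + θ') = sliceSnd p θ + sliceSnd p θ' := by
  ext x : 1
  rfl

theorem sliceSnd_sub (p : M₁) (θ θ' : OneForm (I₁.prod I₂) (M₁ × M₂)) :
    sliceSnd p (θ - θ') = sliceSnd p θ - sliceSnd p θ' := by
  ext x : 1
  rfl

theorem liftFst_smul {f : C^∞⟮I₁, M₁; ℝ⟯} {α α' : OneForm I₁ M₁} (h : ∀ p, α' p = f p • α p)
    (x : M₁ × M₂) : liftFst I₂ M₂ α' x = f x.1 • liftFst I₂ M₂ α x := by
  ext v
  refine (liftFst_apply α' x v).trans ?_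
  rw [h]
  exact (congrArg (f x.1 • ·) (liftFst_apply α x v)).symm

theorem liftSnd_smul {f : C^∞⟮I₂, M₂; ℝ⟯} {α α' : OneForm I₂ M₂} (h : ∀ p, α' p = f p • α p)
    (x : M₁ × M₂) : liftSnd I₁ M₁ α' x = f x.2 • liftSnd I₁ M₁ α x := by
  ext v
  refine (liftSnd_apply α' x v).trans ?_
  rw [h]
  exact (congrArg (f x.2 • ·) (liftSnd_apply α x v)).symm

end OneForm

variable {P₁ : ContraTwoTensor I₁ M₁} (hP₁ : IsPoissonTensor P₁)
  {P₂ : ContraTwoTensor I₂ M₂} (hP₂ : IsPoissonTensor P₂) {ν : C^∞⟮I₁, M₁; ℝ⟯}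

omit [FiniteDimensional ℝ E₁] [FiniteDimensional ℝ E₂] [T2Space M₁] [T2Space M₂]
  [SecondCountableTopology M₁] [SecondCountableTopology M₂] in
theorem oneForm_apply_prodVectorField (θ : OneForm (I₁.prod I₂) (M₁ × M₂))
    (Y₁ : SmoothVectorField I₁ M₁) (Y₂ : SmoothVectorField I₂ M₂) (x : M₁ × M₂) :
    θ x (prodVectorField Y₁ Y₂ x)
      = sliceFst x.2 θ x.1 (Y₁ x.1) + sliceSnd x.1 θ x.2 (Y₂ x.2) :=
  covector_apply_eq x (θ x) _

include hP₁ in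
omit [T2Space M₁] [T2Space M₂] [SecondCountableTopology M₁] [SecondCountableTopology M₂] in
-- A smooth bracket of `α` and `β` on `M₁` is obtained here from one on the product, so its
-- existence need not be established separately.
theorem IsFormBracket.sliceFst {α β : OneForm I₁ M₁} {Θ : OneForm (I₁.prod I₂) (M₁ × M₂)}
    (h : IsFormBracket (warpedBivector P₁ P₂ ν) (liftFst I₂ M₂ α) (liftFst I₂ M₂ β) Θ) (q : M₂) :
    IsFormBracket P₁ α β (sliceFst q Θ) := by
  intro Y p
  have h1 := h (prodVectorField Y 0) (p, q)
  have h2 := bracketApply_liftFst_liftFst (P₂ := P₂) hP₁ ν α β Y 0 (p, q)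
  rw [oneForm_apply_prodVectorField] at h1
  have h3 : OneForm.sliceSnd p Θ q ((0 : SmoothVectorField I₂ M₂) q) = 0 :=
    map_zero (OneForm.sliceSnd p Θ q)
  have h4 := h1.trans h2
  rw [h3, add_zero] at h4
  exact h4

include hP₁ in
theorem IsFormBracket.eq_liftFst {α β θ : OneForm I₁ M₁} {Θ : OneForm (I₁.prod I₂) (M₁ × M₂)}
    (h : IsFormBracket (warpedBivector P₁ P₂ ν) (liftFst I₂ M₂ α) (liftFst I₂ M₂ β) Θ)
    (hθ : IsFormBracket P₁ α β θ) : Θ = liftFst I₂ M₂ θ := by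
  refine ext_of_prodVectorField fun Y₁ Y₂ x => ?_
  refine (h _ _).trans ((bracketApply_liftFst_liftFst (P₂ := P₂) hP₁ ν α β Y₁ Y₂ x).trans ?_)
  rw [liftFst_apply]
  exact (hθ Y₁ x.1).symm

include hP₁ hP₂ in
theorem IsFormBracket.eq_zero {α : OneForm I₁ M₁} {β : OneForm I₂ M₂}
    {Θ : OneForm (I₁.prod I₂) (M₁ × M₂)}
    (h : IsFormBracket (warpedBivector P₁ P₂ ν) (liftFst I₂ M₂ α) (liftSnd I₁ M₁ β) Θ) :
    Θ = 0 :=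
  ext_of_prodVectorField fun Y₁ Y₂ x =>
    (h _ _).trans (bracketApply_liftFst_liftSnd hP₁ hP₂ ν α β Y₁ Y₂ x)

include hP₂ in
omit [T2Space M₁] [T2Space M₂] [SecondCountableTopology M₁] [SecondCountableTopology M₂] in
theorem IsFormBracket.sliceSnd_apply {α β : OneForm I₂ M₂} {Θ : OneForm (I₁.prod I₂) (M₁ × M₂)}
    (h : IsFormBracket (warpedBivector P₁ P₂ ν) (liftSnd I₁ M₁ α) (liftSnd I₁ M₁ β) Θ) (p : M₁)
    (Y : SmoothVectorField I₂ M₂) (q : M₂) :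
    sliceSnd p Θ q (Y q) = ν p * bracketApply P₂ α β Y q := by
  have h1 := h (prodVectorField 0 Y) (p, q)
  have h2 := bracketApply_liftSnd_liftSnd (P₁ := P₁) hP₂ ν α β 0 Y (p, q)
  rw [oneForm_apply_prodVectorField] at h1
  have h3 : OneForm.sliceFst q Θ p ((0 : SmoothVectorField I₁ M₁) p) = 0 :=
    map_zero (OneForm.sliceFst q Θ p)
  have h5 : mvfderiv I₁ ν p ((0 : SmoothVectorField I₁ M₁) p) = 0 := map_zero _
  have h4 := h1.trans h2
  rw [h3, zero_add] at h4
  refine h4.trans ?_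
  dsimp only
  rw [h5, mul_zero, add_zero]

variable (I₂ M₂) in
/-- The lift to the product of a function on the first factor. -/
def funFst (f : C^∞⟮I₁, M₁; ℝ⟯) : C^∞⟮I₁.prod I₂, M₁ × M₂; ℝ⟯ :=
  ⟨fun x => f x.1, f.contMDiff.comp contMDiff_fst⟩

variable (I₁ M₁) in
/-- The lift to the product of a function on the second factor. -/
def funSnd (f : C^∞⟮I₂, M₂; ℝ⟯) : C^∞⟮I₁.prod I₂, M₁ × M₂; ℝ⟯ :=
  ⟨fun x => f x.2, f.contMDiff.comp contMDiff_snd⟩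

theorem IsFormBracket.eq_liftSnd {α β θ : OneForm I₂ M₂} {Θ : OneForm (I₁.prod I₂) (M₁ × M₂)}
    (h : IsFormBracket (warpedBivector P₁ P₂ ν) (liftSnd I₁ M₁ α) (liftSnd I₁ M₁ β) Θ)
    (hθ : IsFormBracket P₂ α β θ) :
    Θ = mulFun (funFst I₂ M₂ ν) (liftSnd I₁ M₁ θ)
      + mulFun (funSnd I₁ M₁ (hP₂.pairing α β)) (liftFst I₂ M₂ (OneForm.d ν)) := by
  refine ext_of_prodVectorField fun Y₁ Y₂ x => ?_
  refine (h _ _).trans ((bracketApply_liftSnd_liftSnd (P₁ := P₁) hP₂ ν α β Y₁ Y₂ x).trans ?_)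
  have h1 : bracketApply P₂ α β Y₂ x.2 = liftSnd I₁ M₁ θ x (prodVectorField Y₁ Y₂ x) := by
    rw [liftSnd_apply]
    exact (hθ Y₂ x.2).symm
  have h2 : mvfderiv I₁ ν x.1 (Y₁ x.1)
      = liftFst I₂ M₂ (OneForm.d ν) x (prodVectorField Y₁ Y₂ x) := by
    rw [liftFst_apply]
    rfl
  rw [h1, h2]
  rfl

include hP₂ in
omit [T2Space M₂] [SecondCountableTopology M₂] in
/-- The horizontal part of the bracket of two vertical forms is `Π₂ (α, β) dν`. -/
theorem IsFormBracket.restrictFst_eq {α β : OneForm I₂ M₂} {Θ : OneForm (I₁.prod I₂) (M₁ × M₂)}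
    (h : IsFormBracket (warpedBivector P₁ P₂ ν) (liftSnd I₁ M₁ α) (liftSnd I₁ M₁ β) Θ)
    (x : M₁ × M₂) : restrictFst x (Θ x) = P₂ x.2 (α x.2) (β x.2) • OneForm.d ν x.1 := by
  ext v
  obtain ⟨Y, rfl⟩ := exists_vectorField_eq x.1 v
  -- Testing on `(Y, 0)` removes the vertical part, so no bracket of `α` and `β` on `M₂` has to be
  -- given.
  have h1 := h (prodVectorField Y 0) x
  have h2 := bracketApply_liftSnd_liftSnd (P₁ := P₁) hP₂ ν α β Y 0 x
  rw [oneForm_apply_prodVectorField] at h1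
  have h3 : OneForm.sliceSnd x.1 Θ x.2 ((0 : SmoothVectorField I₂ M₂) x.2) = 0 :=
    map_zero (OneForm.sliceSnd x.1 Θ x.2)
  have h5 : bracketApply P₂ α β 0 x.2 = 0 := by
    have hz : ∀ γ δ : OneForm I₂ M₂, lieDerivativeApply (fun y => anchor P₂ y (γ y)) δ
        (0 : SmoothVectorField I₂ M₂) x.2 = 0 := by
      intro γ δ
      unfold lieDerivativeApply
      have e1 : (fun y => δ y ((0 : SmoothVectorField I₂ M₂) y)) = fun _ => (0 : ℝ) := by
        funext y
        exact map_zero (δ y)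
      have e2 : mlieBracket I₂ (fun y => anchor P₂ y (γ y)) (0 : SmoothVectorField I₂ M₂) = 0 :=
        mlieBracket_zero_right
      rw [e1, e2, mvfderiv_const]
      have e3 : δ x.2 ((0 : (y : M₂) → TangentSpace I₂ y) x.2) = 0 := map_zero (δ x.2)
      rw [e3]
      simp
    unfold bracketApply
    rw [hz, hz]
    have e4 : ∀ A : CotangentSpace I₂ x.2, A ((0 : SmoothVectorField I₂ M₂) x.2) = 0 :=
      fun A => map_zero A
    rw [e4]
    norm_num
  have h4 := h1.trans h2
  rw [h3, add_zero, h5, mul_zero, zero_add] at h4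
  exact h4

end FormBracketOnProduct

/-! ### Levi-Civita connections of the factors, obtained from slices -/

section ConnectionsOnFactors

variable {E₁ : Type*} [NormedAddCommGroup E₁] [NormedSpace ℝ E₁] [FiniteDimensional ℝ E₁]
  {H₁ : Type*} [TopologicalSpace H₁] {I₁ : ModelWithCorners ℝ E₁ H₁}
  {M₁ : Type*} [TopologicalSpace M₁] [ChartedSpace H₁ M₁] [IsManifold I₁ ∞ M₁]
  [T2Space M₁] [SecondCountableTopology M₁]
  {E₂ : Type*} [NormedAddCommGroup E₂] [NormedSpace ℝ E₂] [FiniteDimensional ℝ E₂]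
  {H₂ : Type*} [TopologicalSpace H₂] {I₂ : ModelWithCorners ℝ E₂ H₂}
  {M₂ : Type*} [TopologicalSpace M₂] [ChartedSpace H₂ M₂] [IsManifold I₂ ∞ M₂]
  [T2Space M₂] [SecondCountableTopology M₂]

open OneForm

section CasimirDerivative

omit [SecondCountableTopology M₁] in
-- The Casimir condition concerns differentials of global functions, and every covector at `p` is
-- one. Thus `df` vanishes on the whole image of the anchor.
theorem IsCasimir.mvfderiv_anchor {P₁ : ContraTwoTensor I₁ M₁} (hP₁ : IsPoissonTensor P₁)
    {f : C^∞⟮I₁, M₁; ℝ⟯} (hf : IsCasimir P₁ f) (p : M₁) (α : CotangentSpace I₁ p) :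
    mvfderiv I₁ f p (anchor P₁ p α) = 0 := by
  obtain ⟨h, rfl⟩ := exists_mvfderiv_eq p α
  rw [apply_anchor, hP₁.skew, neg_eq_zero]
  exact hf h p

end CasimirDerivative

omit [T2Space M₁] [SecondCountableTopology M₁] [T2Space M₂] [SecondCountableTopology M₂]

omit [FiniteDimensional ℝ E₁] [IsManifold I₁ ∞ M₁] in
theorem mdifferentiableAt_inv_sq {f : C^∞⟮I₁, M₁; ℝ⟯} (hf : ∀ p, 0 < f p) (p : M₁) :
    MDifferentiableAt I₁ 𝓘(ℝ, ℝ) (fun p => (f p ^ 2)⁻¹) p := by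
  have h : DifferentiableAt ℝ (fun t : ℝ => (t ^ 2)⁻¹) (f p) :=
    (differentiableAt_id.pow 2).inv (pow_pos (hf p) 2).ne'
  exact MDifferentiableAt.comp (g := fun t : ℝ => (t ^ 2)⁻¹) (f := f) p h.mdifferentiableAt ((f.contMDiff p).mdifferentiableAt (by simp))

omit [FiniteDimensional ℝ E₁] [IsManifold I₁ ∞ M₁] in
theorem mvfderiv_inv_sq_eq_zero {f : C^∞⟮I₁, M₁; ℝ⟯} (hf : ∀ p, 0 < f p) {p : M₁}
    {v : TangentSpace I₁ p} (hv : mvfderiv I₁ f p v = 0) :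
    mvfderiv I₁ (fun p => (f p ^ 2)⁻¹) p v = 0 := by
  have h : DifferentiableAt ℝ (fun t : ℝ => (t ^ 2)⁻¹) (f p) :=
    (differentiableAt_id.pow 2).inv (pow_pos (hf p) 2).ne'
  have e := mvfderiv_comp_map (J := 𝓘(ℝ, ℝ)) (G := fun t : ℝ => (t ^ 2)⁻¹) (Φ := f)
    h.mdifferentiableAt ((f.contMDiff p).mdifferentiableAt (by simp)) v
  refine e.trans ?_
  have hv' : mfderiv I₁ 𝓘(ℝ, ℝ) f p v = 0 := hv
  rw [hv', map_zero]

variable {g₁ : CoTwoTensor I₁ M₁} {g₂ : CoTwoTensor I₂ M₂} (hg₁ : IsInnerField g₁)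
  (hg₂ : IsInnerField g₂) {f : C^∞⟮I₁, M₁; ℝ⟯} (hf : ∀ p, 0 < f p)
include hg₁ hg₂ hf

theorem cometric_liftFst_right (x : M₁ × M₂) (θ : CotangentSpace (I₁.prod I₂) x)
    (γ : OneForm I₁ M₁) :
    cometric (warpedMetric g₁ g₂ f) x θ (liftFst I₂ M₂ γ x)
      = cometric g₁ x.1 (restrictFst x θ) (γ x.1) := by
  rw [cometric_warpedMetric hg₁ hg₂ hf, restrictFst_liftFst, restrictSnd_liftFst, map_zero,
    mul_zero, add_zero]

theorem cometric_liftFst_left (x : M₁ × M₂) (θ : CotangentSpace (I₁.prod I₂) x)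
    (γ : OneForm I₁ M₁) :
    cometric (warpedMetric g₁ g₂ f) x (liftFst I₂ M₂ γ x) θ
      = cometric g₁ x.1 (γ x.1) (restrictFst x θ) := by
  rw [cometric_warpedMetric hg₁ hg₂ hf, restrictFst_liftFst, restrictSnd_liftFst, map_zero,
    zero_apply, mul_zero, add_zero]

theorem cometric_liftSnd_right (x : M₁ × M₂) (θ : CotangentSpace (I₁.prod I₂) x)
    (γ : OneForm I₂ M₂) :
    cometric (warpedMetric g₁ g₂ f) x θ (liftSnd I₁ M₁ γ x)
      = (f x.1 ^ 2)⁻¹ * cometric g₂ x.2 (restrictSnd x θ) (γ x.2) := by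
  rw [cometric_warpedMetric hg₁ hg₂ hf, restrictFst_liftSnd, restrictSnd_liftSnd, map_zero,
    zero_add]

theorem cometric_liftSnd_left (x : M₁ × M₂) (θ : CotangentSpace (I₁.prod I₂) x)
    (γ : OneForm I₂ M₂) :
    cometric (warpedMetric g₁ g₂ f) x (liftSnd I₁ M₁ γ x) θ
      = (f x.1 ^ 2)⁻¹ * cometric g₂ x.2 (γ x.2) (restrictSnd x θ) := by
  rw [cometric_warpedMetric hg₁ hg₂ hf, restrictFst_liftSnd, restrictSnd_liftSnd, map_zero,
    zero_apply, zero_add]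

theorem mvfderiv_cometric_liftFst (β γ : OneForm I₁ M₁) (x : M₁ × M₂)
    (v : TangentSpace (I₁.prod I₂) x) :
    mvfderiv (I₁.prod I₂) (fun y => cometric (warpedMetric g₁ g₂ f) y (liftFst I₂ M₂ β y)
      (liftFst I₂ M₂ γ y)) x v
      = mvfderiv I₁ (fun p => cometric g₁ p (β p) (γ p)) x.1 (tangentFst x v) := by
  rw [← mvfderiv_comp_fst]
  congr 2
  funext y
  rw [cometric_liftFst_right hg₁ hg₂ hf, restrictFst_liftFst]

theorem mvfderiv_cometric_liftFst_liftSnd (β : OneForm I₁ M₁) (γ : OneForm I₂ M₂) (x : M₁ × M₂) :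
    mvfderiv (I₁.prod I₂) (fun y => cometric (warpedMetric g₁ g₂ f) y (liftFst I₂ M₂ β y)
      (liftSnd I₁ M₁ γ y)) x = 0 := by
  rw [← mvfderiv_const (I := I₁.prod I₂) (c := (0 : ℝ)) (x := x)]
  congr 1
  funext y
  rw [cometric_liftSnd_right hg₁ hg₂ hf, restrictSnd_liftFst, map_zero, zero_apply, mul_zero]

theorem mvfderiv_cometric_liftSnd (β γ : OneForm I₂ M₂) (x : M₁ × M₂)
    (v : TangentSpace (I₁.prod I₂) x) (hv : mvfderiv I₁ f x.1 (tangentFst x v) = 0) :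
    mvfderiv (I₁.prod I₂) (fun y => cometric (warpedMetric g₁ g₂ f) y (liftSnd I₁ M₁ β y)
      (liftSnd I₁ M₁ γ y)) x v
      = (f x.1 ^ 2)⁻¹
        * mvfderiv I₂ (fun p => cometric g₂ p (β p) (γ p)) x.2 (tangentSnd x v) := by
  have h := mvfderiv_mul_prod_of_eq_zero (k := fun p => (f p ^ 2)⁻¹)
    (h := fun q => cometric g₂ q (β q) (γ q)) (mdifferentiableAt_inv_sq hf x.1)
    (inv_ne_zero (pow_pos (hf x.1) 2).ne') v (mvfderiv_inv_sq_eq_zero hf hv)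
  rw [← h]
  congr 2
  funext y
  rw [cometric_liftSnd_right hg₁ hg₂ hf, restrictSnd_liftSnd]

omit hg₁ hg₂ hf

variable {P₁ : ContraTwoTensor I₁ M₁} (hP₁ : IsPoissonTensor P₁)
  {P₂ : ContraTwoTensor I₂ M₂} (hP₂ : IsPoissonTensor P₂) {ν : C^∞⟮I₁, M₁; ℝ⟯}
  (D : ContravariantConnection (I₁.prod I₂) (M₁ × M₂) (warpedBivector P₁ P₂ ν))

theorem tangentFst_anchor_liftFst (α : OneForm I₁ M₁) (x : M₁ × M₂) :
    tangentFst x (anchor (warpedBivector P₁ P₂ ν) x (liftFst I₂ M₂ α x))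
      = anchor P₁ x.1 (α x.1) := by
  rw [anchor_warpedBivector, tangentFst_mk, restrictFst_liftFst]

theorem tangentSnd_anchor_liftFst (α : OneForm I₁ M₁) (x : M₁ × M₂) :
    tangentSnd x (anchor (warpedBivector P₁ P₂ ν) x (liftFst I₂ M₂ α x)) = 0 := by
  rw [anchor_warpedBivector, tangentSnd_mk, restrictSnd_liftFst, anchor_zero, smul_zero]

theorem tangentFst_anchor_liftSnd (α : OneForm I₂ M₂) (x : M₁ × M₂) :
    tangentFst x (anchor (warpedBivector P₁ P₂ ν) x (liftSnd I₁ M₁ α x)) = 0 := by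
  rw [anchor_warpedBivector, tangentFst_mk, restrictFst_liftSnd, anchor_zero]

theorem tangentSnd_anchor_liftSnd (α : OneForm I₂ M₂) (x : M₁ × M₂) :
    tangentSnd x (anchor (warpedBivector P₁ P₂ ν) x (liftSnd I₁ M₁ α x))
      = ν x.1 • anchor P₂ x.2 (α x.2) := by
  rw [anchor_warpedBivector, tangentSnd_mk, restrictSnd_liftSnd]

namespace ContravariantConnection

/-- The connection induced on the first factor through the slice `M₁ × {q}`. -/
def sliceFst (q : M₂) : ContravariantConnection I₁ M₁ P₁ where
  D α β := OneForm.sliceFst q (D.D (liftFst I₂ M₂ α) (liftFst I₂ M₂ β))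
  add_left α α' β := by rw [liftFst_add, D.add_left, sliceFst_add]
  add_right α β β' := by rw [liftFst_add, D.add_right, sliceFst_add]
  smul_left k α α' β h p := by
    have h1 := D.smul_left (funFst I₂ M₂ k) (liftFst I₂ M₂ α) (liftFst I₂ M₂ α')
      (liftFst I₂ M₂ β) (liftFst_smul h) (p, q)
    rw [sliceFst_apply, h1, map_smul]
    rfl
  leibniz k α β β' h p := by
    have h1 := D.leibniz (funFst I₂ M₂ k) (liftFst I₂ M₂ α) (liftFst I₂ M₂ β)
      (liftFst I₂ M₂ β') (liftFst_smul h) (p, q)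
    have h2 : mvfderiv (I₁.prod I₂) (funFst I₂ M₂ k) (p, q)
        (anchor (warpedBivector P₁ P₂ ν) (p, q) (liftFst I₂ M₂ α (p, q)))
        = mvfderiv I₁ k p (anchor P₁ p (α p)) := by
      refine (mvfderiv_comp_fst k (p, q) _).trans ?_
      rw [tangentFst_anchor_liftFst]
    rw [sliceFst_apply, h1, h2, map_add, map_smul, map_smul, restrictFst_liftFst]
    rfl

/-- The connection induced on the second factor through the slice `{p} × M₂`, rescaled by
`(ν p)⁻¹`. -/
def sliceSnd (p : M₁) (hp : ν p ≠ 0) : ContravariantConnection I₂ M₂ P₂ where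
  D α β := (ν p)⁻¹ • OneForm.sliceSnd p (D.D (liftSnd I₁ M₁ α) (liftSnd I₁ M₁ β))
  add_left α α' β := by rw [liftSnd_add, D.add_left, sliceSnd_add, smul_add]
  add_right α β β' := by rw [liftSnd_add, D.add_right, sliceSnd_add, smul_add]
  smul_left k α α' β h q := by
    have h1 := D.smul_left (funSnd I₁ M₁ k) (liftSnd I₁ M₁ α) (liftSnd I₁ M₁ α')
      (liftSnd I₁ M₁ β) (liftSnd_smul h) (p, q)
    rw [smul_apply', smul_apply', OneForm.sliceSnd_apply, h1, map_smul, smul_comm]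
    rfl
  leibniz k α β β' h q := by
    have h1 := D.leibniz (funSnd I₁ M₁ k) (liftSnd I₁ M₁ α) (liftSnd I₁ M₁ β)
      (liftSnd I₁ M₁ β') (liftSnd_smul h) (p, q)
    -- The anchor of a vertical form is `ν` times the anchor of `Π₂`. The Leibniz rule on the slice
    -- thus carries a factor `ν p`, which the normalization by `(ν p)⁻¹` removes.
    have h2 : mvfderiv (I₁.prod I₂) (funSnd I₁ M₁ k) (p, q)
        (anchor (warpedBivector P₁ P₂ ν) (p, q) (liftSnd I₁ M₁ α (p, q)))
        = ν p * mvfderiv I₂ k q (anchor P₂ q (α q)) := by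
      refine (mvfderiv_comp_snd k (p, q) _).trans ?_
      rw [tangentSnd_anchor_liftSnd, map_smul, smul_eq_mul]
    rw [smul_apply', smul_apply', OneForm.sliceSnd_apply, h1, h2, map_add, map_smul, map_smul,
      restrictSnd_liftSnd, smul_add, smul_smul _ (_ * _), inv_mul_cancel_left₀ hp, smul_comm]
    rfl

variable {D} (hD : D.IsLeviCivita (warpedMetric g₁ g₂ f))
include hg₁ hg₂ hf hD

include hP₁ in
-- Discarding the vertical part of `𝓓_{α^h} β^h` is harmless: in the metric identity it is only
-- paired with horizontal forms, to which it is orthogonal.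
theorem IsLeviCivita.sliceFst (q : M₂) : (D.sliceFst q).IsLeviCivita g₁ where
  torsion_free α β := by
    have h := (hD.torsion_free (liftFst I₂ M₂ α) (liftFst I₂ M₂ β)).sliceFst hP₁ q
    rwa [sliceFst_sub] at h
  metric α β γ p := by
    have h := hD.metric (liftFst I₂ M₂ α) (liftFst I₂ M₂ β) (liftFst I₂ M₂ γ) (p, q)
    rw [mvfderiv_cometric_liftFst hg₁ hg₂ hf, tangentFst_anchor_liftFst,
      cometric_liftFst_right hg₁ hg₂ hf, cometric_liftFst_left hg₁ hg₂ hf] at h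
    exact h

include hP₂ in
-- The weight `f⁻²` is constant along vertical anchors, so it cancels from the metric identity
-- without any appeal to the Casimir condition.
theorem IsLeviCivita.sliceSnd (p : M₁) (hp : ν p ≠ 0) :
    (D.sliceSnd p hp).IsLeviCivita g₂ where
  torsion_free α β := by
    intro Y q
    have h := (hD.torsion_free (liftSnd I₁ M₁ α) (liftSnd I₁ M₁ β)).sliceSnd_apply hP₂ p Y q
    rw [sliceSnd_sub] at h
    change ((ν p)⁻¹ • OneForm.sliceSnd p (D.D (liftSnd I₁ M₁ α) (liftSnd I₁ M₁ β))
      - (ν p)⁻¹ • OneForm.sliceSnd p (D.D (liftSnd I₁ M₁ β) (liftSnd I₁ M₁ α))) q (Y q)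
        = bracketApply P₂ α β Y q
    rw [← smul_sub, smul_apply']
    refine (congrArg ((ν p)⁻¹ * ·) h).trans ?_
    exact inv_mul_cancel_left₀ hp _
  metric α β γ q := by
    have h := hD.metric (liftSnd I₁ M₁ α) (liftSnd I₁ M₁ β) (liftSnd I₁ M₁ γ) (p, q)
    rw [mvfderiv_cometric_liftSnd hg₁ hg₂ hf _ _ _ _
      (by rw [tangentFst_anchor_liftSnd, map_zero]), tangentSnd_anchor_liftSnd,
      cometric_liftSnd_right hg₁ hg₂ hf, cometric_liftSnd_left hg₁ hg₂ hf, ← mul_add] at h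
    have h2 := mul_left_cancel₀ (inv_ne_zero (pow_pos (hf p) 2).ne') h
    rw [map_smul, smul_eq_mul] at h2
    have h3 := congrArg ((ν p)⁻¹ * ·) h2
    dsimp only at h3
    rw [inv_mul_cancel_left₀ hp] at h3
    refine h3.trans ?_
    change _ = cometric g₂ q ((ν p)⁻¹ • OneForm.sliceSnd p _ q) (γ q)
      + cometric g₂ q (β q) ((ν p)⁻¹ • OneForm.sliceSnd p _ q)
    rw [map_smul, map_smul, smul_apply, smul_eq_mul, smul_eq_mul, ← mul_add]
    rfl

end ContravariantConnection

end ConnectionsOnFactors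

/-! ### The Levi-Civita connection of the warped product on lifted forms -/

section CurvatureOfProduct

variable {E₁ : Type*} [NormedAddCommGroup E₁] [NormedSpace ℝ E₁] [FiniteDimensional ℝ E₁]
  {H₁ : Type*} [TopologicalSpace H₁] {I₁ : ModelWithCorners ℝ E₁ H₁}
  {M₁ : Type*} [TopologicalSpace M₁] [ChartedSpace H₁ M₁] [IsManifold I₁ ∞ M₁]
  [T2Space M₁] [SecondCountableTopology M₁]
  {E₂ : Type*} [NormedAddCommGroup E₂] [NormedSpace ℝ E₂] [FiniteDimensional ℝ E₂]
  {H₂ : Type*} [TopologicalSpace H₂] {I₂ : ModelWithCorners ℝ E₂ H₂}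
  {M₂ : Type*} [TopologicalSpace M₂] [ChartedSpace H₂ M₂] [IsManifold I₂ ∞ M₂]
  [T2Space M₂] [SecondCountableTopology M₂]

open OneForm

/-- The braid argument behind the uniqueness of Levi-Civita connections. Exchanging the outer slots
as `(12)(23)(12)` costs one sign, as `(23)(12)(23)` two, so `S = -S`. In the applications `S` is a
difference of connections, symmetric by torsion-freeness and skew by compatibility with the
cometric. -/
theorem eq_zero_of_symm_of_skew {ι : Type*} (S : ι → ι → ι → ℝ)
    (hs : ∀ a b c, S a b c = S b a c) (hk : ∀ a b c, S a b c = - S a c b) (a b c : ι) :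
    S a b c = 0 := by
  have h1 := hs a b c
  have h2 := hk b a c
  have h3 := hs b c a
  have h4 := hk c b a
  have h5 := hs c a b
  have h6 := hk a c b
  linarith

/-- `formBracket` is a choice, meaningful only once some form satisfies the defining formula.
Torsion-freeness supplies one, and uniqueness identifies it with the choice. -/
theorem ContravariantConnection.IsLeviCivita.formBracket_eq {P₁ : ContraTwoTensor I₁ M₁}
    {g₁ : CoTwoTensor I₁ M₁} {D₁ : ContravariantConnection I₁ M₁ P₁} (hD₁ : D₁.IsLeviCivita g₁)
    (α β : OneForm I₁ M₁) : formBracket P₁ α β = D₁.D α β - D₁.D β α :=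
  IsFormBracket.unique (Classical.epsilon_spec ⟨_, hD₁.torsion_free α β⟩) (hD₁.torsion_free α β)

variable {g₁ : CoTwoTensor I₁ M₁} {g₂ : CoTwoTensor I₂ M₂} (hg₁ : IsInnerField g₁)
  (hg₂ : IsInnerField g₂) {f : C^∞⟮I₁, M₁; ℝ⟯} (hf : ∀ p, 0 < f p)
  {P₁ : ContraTwoTensor I₁ M₁} (hP₁ : IsPoissonTensor P₁) (hcas : IsCasimir P₁ f)
  {P₂ : ContraTwoTensor I₂ M₂} (hP₂ : IsPoissonTensor P₂) {ν : C^∞⟮I₁, M₁; ℝ⟯}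
  {D : ContravariantConnection (I₁.prod I₂) (M₁ × M₂) (warpedBivector P₁ P₂ ν)}
  (hD : D.IsLeviCivita (warpedMetric g₁ g₂ f))
  {D₁ : ContravariantConnection I₁ M₁ P₁} (hD₁ : D₁.IsLeviCivita g₁)
  {D₂ : ContravariantConnection I₂ M₂ P₂} (hD₂ : D₂.IsLeviCivita g₂)

namespace ContravariantConnection.IsLeviCivita

include hP₁ hP₂ hD in
theorem liftSnd_liftFst (α : OneForm I₁ M₁) (β : OneForm I₂ M₂) :
    D.D (liftSnd I₁ M₁ β) (liftFst I₂ M₂ α) = D.D (liftFst I₂ M₂ α) (liftSnd I₁ M₁ β) :=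
  (sub_eq_zero.1 ((hD.torsion_free _ _).eq_zero hP₁ hP₂)).symm

include hg₁ hg₂ hf hP₁ hP₂ hD in
theorem cometric_restrictSnd_liftFst_liftFst (α β : OneForm I₁ M₁) (γ : OneForm I₂ M₂)
    (x : M₁ × M₂) :
    (f x.1 ^ 2)⁻¹ * cometric g₂ x.2
        (restrictSnd x (D.D (liftFst I₂ M₂ α) (liftFst I₂ M₂ β) x)) (γ x.2)
      = - cometric g₁ x.1 (β x.1) (restrictFst x (D.D (liftSnd I₁ M₁ γ) (liftFst I₂ M₂ α) x)) := by
  have h := hD.metric (liftFst I₂ M₂ α) (liftFst I₂ M₂ β) (liftSnd I₁ M₁ γ) x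
  rw [mvfderiv_cometric_liftFst_liftSnd hg₁ hg₂ hf, zero_apply,
    cometric_liftSnd_right hg₁ hg₂ hf, cometric_liftFst_left hg₁ hg₂ hf,
    ← hD.liftSnd_liftFst hP₁ hP₂] at h
  linarith

include hg₁ hg₂ hf hP₁ hP₂ hD in
-- The vertical part is symmetric in `α, β`, because `[α^h, β^h]` is horizontal. It is also skew:
-- paired with `γ^v` it equals `-g̃₁(β, 𝓓_{γ^v} α^h)`, and symmetrizing gives minus the derivative
-- of `g̃₁(α, β)` in a vertical direction, which is `0`.
theorem restrictSnd_liftFst_liftFst (α β : OneForm I₁ M₁) (x : M₁ × M₂) :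
    restrictSnd x (D.D (liftFst I₂ M₂ α) (liftFst I₂ M₂ β) x) = 0 := by
  have hf2 := inv_pos.2 (pow_pos (hf x.1) 2)
  -- The test form is the vertical part itself, so that the pairing becomes a squared norm.
  set γ := OneForm.sliceSnd x.1 (D.D (liftFst I₂ M₂ α) (liftFst I₂ M₂ β)) with hγ
  have a1 := hD.cometric_restrictSnd_liftFst_liftFst hg₁ hg₂ hf hP₁ hP₂ α β γ x
  have a2 := hD.cometric_restrictSnd_liftFst_liftFst hg₁ hg₂ hf hP₁ hP₂ β α γ x
  have a3 := hD.metric (liftSnd I₁ M₁ γ) (liftFst I₂ M₂ β) (liftFst I₂ M₂ α) x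
  rw [mvfderiv_cometric_liftFst hg₁ hg₂ hf, tangentFst_anchor_liftSnd, map_zero,
    cometric_liftFst_right hg₁ hg₂ hf, cometric_liftFst_left hg₁ hg₂ hf] at a3
  rw [hg₁.cometric_symm x.1 (α x.1)] at a2
  have hb := hD.torsion_free (liftFst I₂ M₂ α) (liftFst I₂ M₂ β)
  have a4 := hb.eq_liftFst hP₁ (hb.sliceFst hP₁ x.2)
  have a5 : restrictSnd x (D.D (liftFst I₂ M₂ α) (liftFst I₂ M₂ β) x)
      = restrictSnd x (D.D (liftFst I₂ M₂ β) (liftFst I₂ M₂ α) x) := by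
    rw [← sub_eq_zero, ← map_sub, ← sub_apply', a4, restrictSnd_liftFst]
  rw [← a5] at a2
  have a6 : γ x.2 = restrictSnd x (D.D (liftFst I₂ M₂ α) (liftFst I₂ M₂ β) x) := rfl
  rw [a6] at a1 a2
  refine hg₂.eq_zero_of_cometric_self x.2 _ ?_
  refine (mul_eq_zero.1 ?_).resolve_left hf2.ne'
  linarith

include hg₁ hg₂ hf hP₁ hP₂ hD hD₁ in
/-- On forms lifted from the first factor, the Levi-Civita connection of the warped product is
the one of the first factor. -/
theorem liftFst_liftFst (α β : OneForm I₁ M₁) :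
    D.D (liftFst I₂ M₂ α) (liftFst I₂ M₂ β) = liftFst I₂ M₂ (D₁.D α β) := by
  ext x : 1
  refine covector_ext x ?_ ?_
  -- The difference between the horizontal part of `𝓓` and `𝓓¹`, as a trilinear expression at the
  -- fixed point `x`. Inserting the difference in the third slot at the end yields its squared norm.
  · set S : OneForm I₁ M₁ → OneForm I₁ M₁ → OneForm I₁ M₁ → ℝ := fun α β γ =>
      cometric g₁ x.1 (restrictFst x (D.D (liftFst I₂ M₂ α) (liftFst I₂ M₂ β) x) - D₁.D α β x.1)
        (γ x.1) with hS
    have hs : ∀ a b c, S a b c = S b a c := by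
      intro a b c
      have e := (hD.torsion_free (liftFst I₂ M₂ a) (liftFst I₂ M₂ b)).eq_liftFst hP₁
        (hD₁.torsion_free a b)
      have e2 := congrArg (fun θ : OneForm (I₁.prod I₂) (M₁ × M₂) => restrictFst x (θ x)) e
      rw [restrictFst_liftFst, sub_apply', map_sub, sub_apply'] at e2
      simp only [hS]
      congr 2
      rw [sub_eq_sub_iff_sub_eq_sub]
      exact e2
    have hk : ∀ a b c, S a b c = - S a c b := by
      intro a b c
      have e1 := hD.metric (liftFst I₂ M₂ a) (liftFst I₂ M₂ b) (liftFst I₂ M₂ c) x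
      rw [mvfderiv_cometric_liftFst hg₁ hg₂ hf, tangentFst_anchor_liftFst,
        cometric_liftFst_right hg₁ hg₂ hf, cometric_liftFst_left hg₁ hg₂ hf] at e1
      have e2 := hD₁.metric a b c x.1
      simp only [hS, map_sub, sub_apply]
      rw [hg₁.cometric_symm x.1 (b x.1)] at e1 e2
      linarith
    have h := eq_zero_of_symm_of_skew S hs hk α β
      (OneForm.sliceFst x.2 (D.D (liftFst I₂ M₂ α) (liftFst I₂ M₂ β)) - D₁.D α β)
    rw [restrictFst_liftFst]
    exact sub_eq_zero.1 (hg₁.eq_zero_of_cometric_self x.1 _ h)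
  · rw [restrictSnd_liftFst, hD.restrictSnd_liftFst_liftFst hg₁ hg₂ hf hP₁ hP₂]

include hg₁ hg₂ hf hP₁ hP₂ hD hD₁ in
theorem curvature_liftFst (α β γ : OneForm I₁ M₁) :
    D.curvature (liftFst I₂ M₂ α) (liftFst I₂ M₂ β) (liftFst I₂ M₂ γ)
      = liftFst I₂ M₂ (D₁.curvature α β γ) := by
  have h := hD.liftFst_liftFst hg₁ hg₂ hf hP₁ hP₂ hD₁
  unfold curvature
  rw [hD.formBracket_eq, hD₁.formBracket_eq, h α β, h β α, ← liftFst_sub]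
  simp only [h, ← liftFst_sub]

include hg₁ hg₂ hf hP₁ hP₂ hD hD₁ in
theorem sectionalCurvature_liftFst (α β : OneForm I₁ M₁) (x : M₁ × M₂) :
    D.sectionalCurvature (warpedMetric g₁ g₂ f) (liftFst I₂ M₂ α) (liftFst I₂ M₂ β) x
      = D₁.sectionalCurvature g₁ α β x.1 := by
  unfold sectionalCurvature
  rw [hD.curvature_liftFst hg₁ hg₂ hf hP₁ hP₂ hD₁]
  simp only [cometric_liftFst_right hg₁ hg₂ hf, restrictFst_liftFst]

include hg₁ hg₂ hf hP₁ hP₂ hD in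
theorem cometric_restrictFst_liftSnd_liftSnd (α β : OneForm I₂ M₂) (γ : OneForm I₁ M₁)
    (x : M₁ × M₂) :
    cometric g₁ x.1 (restrictFst x (D.D (liftSnd I₁ M₁ α) (liftSnd I₁ M₁ β) x)) (γ x.1)
      = - ((f x.1 ^ 2)⁻¹ * cometric g₂ x.2 (β x.2)
        (restrictSnd x (D.D (liftFst I₂ M₂ γ) (liftSnd I₁ M₁ α) x))) := by
  have h := hD.metric (liftSnd I₁ M₁ α) (liftFst I₂ M₂ γ) (liftSnd I₁ M₁ β) x
  rw [mvfderiv_cometric_liftFst_liftSnd hg₁ hg₂ hf, zero_apply,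
    cometric_liftSnd_right hg₁ hg₂ hf, cometric_liftFst_left hg₁ hg₂ hf,
    hD.liftSnd_liftFst hP₁ hP₂, hg₂.cometric_symm, hg₁.cometric_symm] at h
  linarith

include hg₁ hg₂ hf hP₁ hP₂ hD hcas in
-- The skew part in `α, β` is half the horizontal part `Π₂(α, β) dν` of the bracket. The symmetric
-- part, paired with `γ^h`, is minus the derivative of `f⁻² g̃₂(α, β)` along `♯γ^h`, which vanishes
-- because `f` is Casimir. The form `γ` is taken to be the difference of the two sides, so a squared
-- norm has to vanish.
theorem restrictFst_liftSnd_liftSnd (α β : OneForm I₂ M₂) (x : M₁ × M₂) :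
    restrictFst x (D.D (liftSnd I₁ M₁ α) (liftSnd I₁ M₁ β) x)
      = (2⁻¹ * P₂ x.2 (α x.2) (β x.2)) • OneForm.d ν x.1 := by
  set γ := OneForm.sliceFst x.2 (D.D (liftSnd I₁ M₁ α) (liftSnd I₁ M₁ β))
    - (2⁻¹ * P₂ x.2 (α x.2) (β x.2)) • OneForm.d ν with hγ
  have a1 := hD.cometric_restrictFst_liftSnd_liftSnd hg₁ hg₂ hf hP₁ hP₂ α β γ x
  have a2 := hD.cometric_restrictFst_liftSnd_liftSnd hg₁ hg₂ hf hP₁ hP₂ β α γ x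
  have a3 := hD.metric (liftFst I₂ M₂ γ) (liftSnd I₁ M₁ β) (liftSnd I₁ M₁ α) x
  rw [mvfderiv_cometric_liftSnd hg₁ hg₂ hf _ _ _ _
      (by rw [tangentFst_anchor_liftFst, hcas.mvfderiv_anchor hP₁]), tangentSnd_anchor_liftFst,
      map_zero, mul_zero,
    cometric_liftSnd_right hg₁ hg₂ hf, cometric_liftSnd_left hg₁ hg₂ hf,
    hg₂.cometric_symm _ _ (α x.2)] at a3
  have a4 := (hD.torsion_free (liftSnd I₁ M₁ α) (liftSnd I₁ M₁ β)).restrictFst_eq hP₂ x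
  rw [sub_apply', map_sub] at a4
  have a5 := congrArg (fun θ => cometric g₁ x.1 θ (γ x.1)) a4
  simp only [map_sub, sub_apply, map_smul, smul_apply, smul_eq_mul] at a5
  refine sub_eq_zero.1 (hg₁.eq_zero_of_cometric_self x.1 _ ?_)
  change cometric g₁ x.1 _ (γ x.1) = 0
  simp only [map_sub, sub_apply, map_smul, smul_apply, smul_eq_mul]
  linarith

include hg₁ hg₂ hf hP₁ hP₂ hD hD₂ hcas in
/-- On forms lifted from the second factor, the Levi-Civita connection of the warped product is
`𝓓_α β = ν 𝓓²_α β + ½ Π₂ (α, β) dν`. -/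
theorem liftSnd_liftSnd (α β : OneForm I₂ M₂) :
    D.D (liftSnd I₁ M₁ α) (liftSnd I₁ M₁ β)
      = mulFun (funFst I₂ M₂ ν) (liftSnd I₁ M₁ (D₂.D α β))
        + mulFun (funSnd I₁ M₁ ((2⁻¹ : ℝ) • hP₂.pairing α β)) (liftFst I₂ M₂ (OneForm.d ν)) := by
  ext x : 1
  have hR : (mulFun (funFst I₂ M₂ ν) (liftSnd I₁ M₁ (D₂.D α β))
      + mulFun (funSnd I₁ M₁ ((2⁻¹ : ℝ) • hP₂.pairing α β)) (liftFst I₂ M₂ (OneForm.d ν))) x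
      = ν x.1 • liftSnd I₁ M₁ (D₂.D α β) x
        + (2⁻¹ * P₂ x.2 (α x.2) (β x.2)) • liftFst I₂ M₂ (OneForm.d ν) x := rfl
  rw [hR]
  refine covector_ext x ?_ ?_
  · rw [map_add, map_smul, map_smul, restrictFst_liftFst, restrictFst_liftSnd, smul_zero, zero_add,
      hD.restrictFst_liftSnd_liftSnd hg₁ hg₂ hf hP₁ hcas hP₂]
  · rw [map_add, map_smul, map_smul, restrictSnd_liftFst, restrictSnd_liftSnd, smul_zero, add_zero]
    -- The same uniqueness argument for the vertical part, now compared with `ν 𝓓²`: both the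
    -- bracket and the anchor of vertical forms carry the factor `ν`.
    set S : OneForm I₂ M₂ → OneForm I₂ M₂ → OneForm I₂ M₂ → ℝ := fun α β γ =>
      cometric g₂ x.2 (restrictSnd x (D.D (liftSnd I₁ M₁ α) (liftSnd I₁ M₁ β) x)
        - ν x.1 • D₂.D α β x.2) (γ x.2) with hS
    have hs : ∀ a b c, S a b c = S b a c := by
      intro a b c
      have e := (hD.torsion_free (liftSnd I₁ M₁ a) (liftSnd I₁ M₁ b)).eq_liftSnd hP₂
        (hD₂.torsion_free a b)
      have e2 := congrArg (fun θ : OneForm (I₁.prod I₂) (M₁ × M₂) => restrictSnd x (θ x)) e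
      rw [add_apply', mulFun_apply, mulFun_apply, map_add, map_smul, map_smul,
        restrictSnd_liftSnd, restrictSnd_liftFst, smul_zero, add_zero, sub_apply', map_sub,
        sub_apply', smul_sub] at e2
      simp only [hS]
      congr 2
      rw [sub_eq_sub_iff_sub_eq_sub]
      exact e2
    have hk : ∀ a b c, S a b c = - S a c b := by
      intro a b c
      have e1 := hD.metric (liftSnd I₁ M₁ a) (liftSnd I₁ M₁ b) (liftSnd I₁ M₁ c) x
      rw [mvfderiv_cometric_liftSnd hg₁ hg₂ hf _ _ _ _
        (by rw [tangentFst_anchor_liftSnd, map_zero]), tangentSnd_anchor_liftSnd,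
        cometric_liftSnd_right hg₁ hg₂ hf, cometric_liftSnd_left hg₁ hg₂ hf, ← mul_add] at e1
      have e3 := mul_left_cancel₀ (inv_ne_zero (pow_pos (hf x.1) 2).ne') e1
      have e2 := hD₂.metric a b c x.2
      rw [map_smul, smul_eq_mul, e2] at e3
      simp only [hS, map_sub, sub_apply, map_smul, smul_apply, smul_eq_mul]
      rw [hg₂.cometric_symm x.2 (b x.2), hg₂.cometric_symm x.2 (b x.2)] at e3
      linarith
    have h := eq_zero_of_symm_of_skew S hs hk α β
      (OneForm.sliceSnd x.1 (D.D (liftSnd I₁ M₁ α) (liftSnd I₁ M₁ β)) - ν x.1 • D₂.D α β)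
    exact sub_eq_zero.1 (hg₂.eq_zero_of_cometric_self x.2 _ h)

end ContravariantConnection.IsLeviCivita

end CurvatureOfProduct

section PositiveCurvature

variable {E₁ : Type*} [NormedAddCommGroup E₁] [NormedSpace ℝ E₁] [FiniteDimensional ℝ E₁]
  {H₁ : Type*} [TopologicalSpace H₁] {I₁ : ModelWithCorners ℝ E₁ H₁}
  {M₁ : Type*} [TopologicalSpace M₁] [ChartedSpace H₁ M₁] [IsManifold I₁ ∞ M₁]
  [T2Space M₁] [SecondCountableTopology M₁]
  {E₂ : Type*} [NormedAddCommGroup E₂] [NormedSpace ℝ E₂] [FiniteDimensional ℝ E₂]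
  {H₂ : Type*} [TopologicalSpace H₂] {I₂ : ModelWithCorners ℝ E₂ H₂}
  {M₂ : Type*} [TopologicalSpace M₂] [ChartedSpace H₂ M₂] [IsManifold I₂ ∞ M₂]
  [T2Space M₂] [SecondCountableTopology M₂]

open OneForm

/-! ### Curvature of vertical planes -/

section Vertical

variable {g₁ : CoTwoTensor I₁ M₁} {g₂ : CoTwoTensor I₂ M₂} (hg₁ : IsInnerField g₁)
  (hg₂ : IsInnerField g₂) {f : C^∞⟮I₁, M₁; ℝ⟯} (hf : ∀ p, 0 < f p)
  {P₁ : ContraTwoTensor I₁ M₁} (hP₁ : IsPoissonTensor P₁) (hcas : IsCasimir P₁ f)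
  {P₂ : ContraTwoTensor I₂ M₂} (hP₂ : IsPoissonTensor P₂) {ν : C^∞⟮I₁, M₁; ℝ⟯}
  {D : ContravariantConnection (I₁.prod I₂) (M₁ × M₂) (warpedBivector P₁ P₂ ν)}
  (hD : D.IsLeviCivita (warpedMetric g₁ g₂ f))
  {D₂ : ContravariantConnection I₂ M₂ P₂} (hD₂ : D₂.IsLeviCivita g₂)

namespace ContravariantConnection.IsLeviCivita

include hg₁ hg₂ hf hP₁ hP₂ hD hcas

/-- Since `dν^h` and `δ^v` are orthogonal, `𝓓_{α^v}` moves across the pairing with a sign and meets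
the horizontal part `½ Π₂(α, δ) dν` of `𝓓_{α^v} δ^v`. -/
theorem cometric_liftSnd_d (α δ : OneForm I₂ M₂) (x : M₁ × M₂) :
    cometric (warpedMetric g₁ g₂ f) x
        (D.D (liftSnd I₁ M₁ α) (liftFst I₂ M₂ (OneForm.d ν)) x) (liftSnd I₁ M₁ δ x)
      = - (2⁻¹ * P₂ x.2 (α x.2) (δ x.2)
        * cometric g₁ x.1 (OneForm.d ν x.1) (OneForm.d ν x.1)) := by
  have h := hD.cometric_restrictFst_liftSnd_liftSnd hg₁ hg₂ hf hP₁ hP₂ α δ (OneForm.d ν) x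
  rw [hD.restrictFst_liftSnd_liftSnd hg₁ hg₂ hf hP₁ hcas hP₂, map_smul, smul_apply, smul_eq_mul,
    hg₂.cometric_symm] at h
  rw [cometric_liftSnd_right hg₁ hg₂ hf, hD.liftSnd_liftFst hP₁ hP₂, h, neg_neg]

include hD₂

theorem cometric_liftSnd_liftSnd (α β δ : OneForm I₂ M₂) (x : M₁ × M₂) :
    cometric (warpedMetric g₁ g₂ f) x
        (D.D (liftSnd I₁ M₁ α) (liftSnd I₁ M₁ β) x) (liftSnd I₁ M₁ δ x)
      = (f x.1 ^ 2)⁻¹ * (ν x.1 * cometric g₂ x.2 (D₂.D α β x.2) (δ x.2)) := by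
  rw [hD.liftSnd_liftSnd hg₁ hg₂ hf hP₁ hcas hP₂ hD₂, cometric_liftSnd_right hg₁ hg₂ hf,
    add_apply', mulFun_apply, mulFun_apply, map_add, map_smul, map_smul, restrictSnd_liftSnd,
    restrictSnd_liftFst, smul_zero, add_zero, map_smul, smul_apply, smul_eq_mul]
  rfl

/-- Differentiate `ν (𝓓²_β γ)^v + ½ Π₂(β, γ) dν^h` along `α^v`. The function `ν` is constant in
vertical directions, and the derivative of `Π₂(β, γ)` multiplies `dν^h`, which is orthogonal to
`δ^v`. The coefficient `¼` is a product of two halves, one from this formula and one from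
`cometric_liftSnd_d`. -/
theorem cometric_liftSnd_liftSnd_liftSnd (α β γ δ : OneForm I₂ M₂) (x : M₁ × M₂) :
    cometric (warpedMetric g₁ g₂ f) x
        (D.D (liftSnd I₁ M₁ α) (D.D (liftSnd I₁ M₁ β) (liftSnd I₁ M₁ γ)) x) (liftSnd I₁ M₁ δ x)
      = (f x.1 ^ 2)⁻¹ * (ν x.1 ^ 2 * cometric g₂ x.2 (D₂.D α (D₂.D β γ) x.2) (δ x.2))
        - 4⁻¹ * P₂ x.2 (β x.2) (γ x.2) * P₂ x.2 (α x.2) (δ x.2)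
          * cometric g₁ x.1 (OneForm.d ν x.1) (OneForm.d ν x.1) := by
  have e1 := D.leibniz (funFst I₂ M₂ ν) (liftSnd I₁ M₁ α) (liftSnd I₁ M₁ (D₂.D β γ)) _
    (mulFun_apply _ _) x
  have e2 := D.leibniz (funSnd I₁ M₁ ((2⁻¹ : ℝ) • hP₂.pairing β γ)) (liftSnd I₁ M₁ α)
    (liftFst I₂ M₂ (OneForm.d ν)) _ (mulFun_apply _ _) x
  have z1 : mvfderiv (I₁.prod I₂) (funFst I₂ M₂ ν) x
      (anchor (warpedBivector P₁ P₂ ν) x (liftSnd I₁ M₁ α x)) = 0 := by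
    refine (mvfderiv_comp_fst ν x _).trans ?_
    rw [tangentFst_anchor_liftSnd, map_zero]
  have z2 : cometric (warpedMetric g₁ g₂ f) x (liftFst I₂ M₂ (OneForm.d ν) x)
      (liftSnd I₁ M₁ δ x) = 0 := by
    rw [cometric_liftSnd_right hg₁ hg₂ hf, restrictSnd_liftFst, map_zero, zero_apply, mul_zero]
  rw [z1, zero_smul, add_zero] at e1
  rw [hD.liftSnd_liftSnd hg₁ hg₂ hf hP₁ hcas hP₂ hD₂, D.add_right, add_apply', e1, e2]
  simp only [map_add, map_smul, add_apply, smul_apply, smul_eq_mul]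
  rw [z2, hD.cometric_liftSnd_d hg₁ hg₂ hf hP₁ hcas hP₂,
    hD.cometric_liftSnd_liftSnd hg₁ hg₂ hf hP₁ hcas hP₂ hD₂]
  change ν x.1 * _ + ((2⁻¹ * P₂ x.2 (β x.2) (γ x.2)) * _ + _) = _
  ring

/-- The bracket is `ν [α, β]^v + Π₂(α, β) dν^h`. Its horizontal part acts through `𝓓_{dν^h} γ^v =
𝓓_{γ^v} dν^h`, by the vanishing of mixed brackets, and so contributes a single factor `½`. -/
theorem cometric_formBracket_liftSnd (α β γ δ : OneForm I₂ M₂) (x : M₁ × M₂) :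
    cometric (warpedMetric g₁ g₂ f) x
        (D.D (formBracket (warpedBivector P₁ P₂ ν) (liftSnd I₁ M₁ α) (liftSnd I₁ M₁ β))
          (liftSnd I₁ M₁ γ) x) (liftSnd I₁ M₁ δ x)
      = (f x.1 ^ 2)⁻¹ * (ν x.1 ^ 2
          * cometric g₂ x.2 (D₂.D (formBracket P₂ α β) γ x.2) (δ x.2))
        - 2⁻¹ * P₂ x.2 (α x.2) (β x.2) * P₂ x.2 (γ x.2) (δ x.2)
          * cometric g₁ x.1 (OneForm.d ν x.1) (OneForm.d ν x.1) := by
  have e0 := (hD.torsion_free (liftSnd I₁ M₁ α) (liftSnd I₁ M₁ β)).eq_liftSnd hP₂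
    (hD₂.torsion_free α β)
  rw [← hD.formBracket_eq, ← hD₂.formBracket_eq] at e0
  have e1 := D.smul_left (funFst I₂ M₂ ν) (liftSnd I₁ M₁ (formBracket P₂ α β)) _
    (liftSnd I₁ M₁ γ) (mulFun_apply _ _) x
  have e2 := D.smul_left (funSnd I₁ M₁ (hP₂.pairing α β)) (liftFst I₂ M₂ (OneForm.d ν)) _
    (liftSnd I₁ M₁ γ) (mulFun_apply _ _) x
  rw [e0, D.add_left, add_apply', e1, e2]
  simp only [map_add, map_smul, add_apply, smul_apply, smul_eq_mul]
  rw [← hD.liftSnd_liftFst hP₁ hP₂, hD.cometric_liftSnd_d hg₁ hg₂ hf hP₁ hcas hP₂,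
    hD.cometric_liftSnd_liftSnd hg₁ hg₂ hf hP₁ hcas hP₂ hD₂]
  change ν x.1 * _ + P₂ x.2 (α x.2) (β x.2) * _ = _
  ring

/-- An O'Neill type formula for the curvature of the vertical planes of the warped product. -/
theorem cometric_curvature_liftSnd (α β : OneForm I₂ M₂) (x : M₁ × M₂) :
    cometric (warpedMetric g₁ g₂ f) x
        (D.curvature (liftSnd I₁ M₁ α) (liftSnd I₁ M₁ β) (liftSnd I₁ M₁ β) x)
        (liftSnd I₁ M₁ α x)
      = (f x.1 ^ 2)⁻¹ * (ν x.1 ^ 2 * cometric g₂ x.2 (D₂.curvature α β β x.2) (α x.2))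
        - 3 / 4 * P₂ x.2 (α x.2) (β x.2) ^ 2
          * cometric g₁ x.1 (OneForm.d ν x.1) (OneForm.d ν x.1) := by
  have t1 := hD.cometric_liftSnd_liftSnd_liftSnd hg₁ hg₂ hf hP₁ hcas hP₂ hD₂ α β β α x
  have t2 := hD.cometric_liftSnd_liftSnd_liftSnd hg₁ hg₂ hf hP₁ hcas hP₂ hD₂ β α β α x
  have t3 := hD.cometric_formBracket_liftSnd hg₁ hg₂ hf hP₁ hcas hP₂ hD₂ α β β α x
  have s1 : P₂ x.2 (β x.2) (β x.2) = 0 := by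
    have := hP₂.skew x.2 (β x.2) (β x.2)
    linarith
  -- The constant `¾`: the first term has no correction since `Π₂(β, β) = 0`; by skewness the second
  -- and third, subtracted, contribute `-¼` and `-½` times `Π₂(α, β)² |dν|²`.
  rw [s1] at t1
  rw [hP₂.skew x.2 (β x.2) (α x.2)] at t2 t3
  unfold curvature
  simp only [sub_apply', map_sub, sub_apply]
  rw [t1, t2, t3]
  ring

end ContravariantConnection.IsLeviCivita

end Vertical

/-! ### The degenerate case of the zero bivector field -/

section Dimension

omit [SecondCountableTopology M₁]

omit [FiniteDimensional ℝ E₁] [T2Space M₁] in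
theorem isPoissonTensor_zero : IsPoissonTensor (0 : ContraTwoTensor I₁ M₁) where
  smooth := contMDiff_zeroSection ℝ _
  skew x α β := by simp
  jacobi f h k x := by simp [poissonBracket]

/-- If no two one-forms are linearly independent at some point, every bivector field vanishes. -/
theorem IsPoissonTensor.eq_zero_of_forall_not_linearIndependent {P : ContraTwoTensor I₁ M₁}
    (hP : IsPoissonTensor P)
    (h : ∀ (x : M₁) (α β : OneForm I₁ M₁), ¬ LinearIndependent ℝ ![α x, β x]) : P = 0 := by
  funext x
  ext a b
  obtain ⟨k, rfl⟩ := exists_mvfderiv_eq x a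
  obtain ⟨l, rfl⟩ := exists_mvfderiv_eq x b
  have hd := h x (OneForm.d k) (OneForm.d l)
  have hself : ∀ c, P x c c = 0 := fun c => by
    have := hP.skew x c c
    linarith
  rw [LinearIndependent.pair_iff] at hd
  push Not at hd
  obtain ⟨s, t, hst, hne⟩ := hd
  change P x (OneForm.d k x) (OneForm.d l x) = 0
  -- Pairing the relation `s dk + t dl = 0` with `dl` and with `dk` gives `s Π(dk, dl) = 0` and `t
  -- Π(dk, dl) = 0`, and one of `s, t` is nonzero.
  have e1 := congrArg (fun c => P x c (OneForm.d l x)) hst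
  have e2 := congrArg (fun c => P x (OneForm.d k x) c) hst
  simp only [map_add, map_smul, map_zero, add_apply, smul_apply, zero_apply, smul_eq_mul,
    hself, mul_zero, add_zero, zero_add, mul_eq_zero] at e1 e2
  rcases e1 with h1 | h1
  · exact e2.resolve_left (hne h1)
  · exact h1

variable (I₁ M₁) in
/-- The zero connection, for the zero bivector field. -/
def zeroConnection : ContravariantConnection I₁ M₁ (0 : ContraTwoTensor I₁ M₁) where
  D _ _ := 0
  add_left _ _ _ := (add_zero _).symm
  add_right _ _ _ := (add_zero _).symm
  smul_left _ _ _ _ _ _ := (smul_zero _).symm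
  leibniz k α β β' h x := by
    have hz : anchor (0 : ContraTwoTensor I₁ M₁) x (α x) = 0 := by
      refine tangent_eq_of_forall_covector fun γ => ?_
      rw [apply_anchor]
      simp
    rw [hz, map_zero, zero_smul, add_zero]
    exact (smul_zero _).symm

omit [T2Space M₁] in
theorem isLeviCivita_zeroConnection (g : CoTwoTensor I₁ M₁) :
    (zeroConnection I₁ M₁).IsLeviCivita g where
  torsion_free α β Y x := by
    have hz : ∀ γ : OneForm I₁ M₁, (fun y => anchor (0 : ContraTwoTensor I₁ M₁) y (γ y)) = 0 := by
      intro γ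
      funext y
      refine tangent_eq_of_forall_covector fun γ => ?_
      rw [apply_anchor]
      simp
    have hc : (fun y => (0 : ContraTwoTensor I₁ M₁) y (α y) (β y)) = fun _ => (0 : ℝ) := by
      funext y
      simp
    have e : bracketApply (0 : ContraTwoTensor I₁ M₁) α β Y x = 0 := by
      unfold bracketApply
      rw [hz, hz, hc, lieDerivativeApply_zero_left, lieDerivativeApply_zero_left, mvfderiv_const]
      simp
    refine Eq.trans ?_ e.symm
    change ((0 : OneForm I₁ M₁) - 0) x (Y x) = 0
    rw [sub_zero]
    rfl
  metric α β γ x := by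
    have hz : anchor (0 : ContraTwoTensor I₁ M₁) x (α x) = 0 := by
      refine tangent_eq_of_forall_covector fun γ => ?_
      rw [apply_anchor]
      simp
    rw [hz, map_zero]
    change 0 = cometric g x 0 (γ x) + cometric g x (β x) 0
    simp

end Dimension

/-! ### Transfer of positivity to the factors -/

section Main

variable {g₁ : CoTwoTensor I₁ M₁} {g₂ : CoTwoTensor I₂ M₂} (hg₁ : IsInnerField g₁)
  (hg₂ : IsInnerField g₂) {f : C^∞⟮I₁, M₁; ℝ⟯} (hf : ∀ p, 0 < f p)
  {P₁ : ContraTwoTensor I₁ M₁} (hP₁ : IsPoissonTensor P₁)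
  {P₂ : ContraTwoTensor I₂ M₂} (hP₂ : IsPoissonTensor P₂) {ν : C^∞⟮I₁, M₁; ℝ⟯}

omit [FiniteDimensional ℝ E₁] [FiniteDimensional ℝ E₂] [T2Space M₁] [T2Space M₂]
  [SecondCountableTopology M₁] [SecondCountableTopology M₂] in
theorem linearIndependent_liftFst {α β : OneForm I₁ M₁} {x : M₁ × M₂}
    (h : LinearIndependent ℝ ![α x.1, β x.1]) :
    LinearIndependent ℝ ![liftFst I₂ M₂ α x, liftFst I₂ M₂ β x] := by
  rw [LinearIndependent.pair_iff] at h ⊢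
  intro s t hst
  refine h s t ?_
  have e := congrArg (restrictFst x) hst
  rw [map_add, map_smul, map_smul, restrictFst_liftFst, restrictFst_liftFst, map_zero] at e
  exact e

omit [FiniteDimensional ℝ E₁] [FiniteDimensional ℝ E₂] [T2Space M₁] [T2Space M₂]
  [SecondCountableTopology M₁] [SecondCountableTopology M₂] in
theorem linearIndependent_liftSnd {α β : OneForm I₂ M₂} {x : M₁ × M₂}
    (h : LinearIndependent ℝ ![α x.2, β x.2]) :
    LinearIndependent ℝ ![liftSnd I₁ M₁ α x, liftSnd I₁ M₁ β x] := by
  rw [LinearIndependent.pair_iff] at h ⊢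
  intro s t hst
  refine h s t ?_
  have e := congrArg (restrictSnd x) hst
  rw [map_add, map_smul, map_smul, restrictSnd_liftSnd, restrictSnd_liftSnd, map_zero] at e
  exact e

include hg₁ hg₂ hf hP₁ hP₂ in
theorem hasPositiveSectionalCurvature_fst [Nonempty M₂]
    (hM : HasPositiveSectionalCurvature (warpedBivector P₁ P₂ ν) (warpedMetric g₁ g₂ f)) :
    HasPositiveSectionalCurvature P₁ g₁ := by
  obtain ⟨D, hD, hpos⟩ := hM
  obtain ⟨q⟩ := ‹Nonempty M₂›
  have hD₁ := hD.sliceFst hg₁ hg₂ hf hP₁ q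
  refine ⟨D.sliceFst q, hD₁, fun p α β h => ?_⟩
  have h1 := hpos (p, q) _ _ (linearIndependent_liftFst (x := (p, q)) h)
  rwa [hD.sectionalCurvature_liftFst hg₁ hg₂ hf hP₁ hP₂ hD₁] at h1

include hg₁ hg₂ hf hP₁ hP₂ in
theorem hasPositiveSectionalCurvature_snd [Nonempty M₁] (hcas : IsCasimir P₁ f)
    (hM : HasPositiveSectionalCurvature (warpedBivector P₁ P₂ ν) (warpedMetric g₁ g₂ f)) :
    HasPositiveSectionalCurvature P₂ g₂ := by
  by_cases hν : ∃ p, ν p ≠ 0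
  · obtain ⟨D, hD, hpos⟩ := hM
    obtain ⟨p, hp⟩ := hν
    have hD₂ := hD.sliceSnd hg₁ hg₂ hf hP₂ p hp
    refine ⟨D.sliceSnd p hp, hD₂, fun q α β h => ?_⟩
    have hli := linearIndependent_liftSnd (I₁ := I₁) (M₁ := M₁) (x := (p, q)) h
    have h1 := hpos (p, q) _ _ hli
    have hden := (isInnerField_warpedMetric hg₁ hg₂ hf).gram_pos (p, q) _ _ hli
    have hnum := (div_pos_iff_of_pos_right hden).1 h1
    rw [hD.cometric_curvature_liftSnd hg₁ hg₂ hf hP₁ hcas hP₂ hD₂] at hnum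
    refine div_pos ?_ (hg₂.gram_pos q _ _ h)
    -- Both Gram determinants are positive, so only numerators matter. The term subtracted in the
    -- vertical curvature is nonnegative, and removing it keeps the numerator positive; the factors
    -- `f⁻²` and `ν²` at `p` are positive as well.
    have hn := hg₁.cometric_self_nonneg p (OneForm.d ν p)
    have h2 : 0 < (f p ^ 2)⁻¹ * (ν p ^ 2 *
        cometric g₂ q ((D.sliceSnd p hp).curvature α β β q) (α q)) := by
      have h3 : 0 ≤ 3 / 4 * P₂ q (α q) (β q) ^ 2 * cometric g₁ p (OneForm.d ν p)
        (OneForm.d ν p) := by positivity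
      dsimp only at hnum
      linarith
    have h4 := (mul_pos_iff_of_pos_left (inv_pos.2 (pow_pos (hf p) 2))).1 h2
    exact (mul_pos_iff_of_pos_left (by positivity)).1 h4
  · push Not at hν
    -- When `ν` vanishes, a slice cannot be normalized to give a connection for `Π₂`. However, `Π₂`
    -- no longer enters the warped bivector and may be replaced by `0`, for which the zero
    -- connection is Levi-Civita and the vertical curvature formula applies.
    have hP : warpedBivector P₁ P₂ ν = warpedBivector P₁ (0 : ContraTwoTensor I₂ M₂) ν := by
      funext x
      ext a b
      rw [warpedBivector_apply, warpedBivector_apply, hν]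
      simp
    rw [hP] at hM
    obtain ⟨D, hD, hpos⟩ := hM
    obtain ⟨p⟩ := ‹Nonempty M₁›
    -- An independent pair would span a vertical plane of zero curvature, contrary to positivity on
    -- the product.
    have hno : ∀ (q : M₂) (α β : OneForm I₂ M₂), ¬ LinearIndependent ℝ ![α q, β q] := by
      intro q α β h
      have h1 := hpos (p, q) _ _ (linearIndependent_liftSnd (x := (p, q)) h)
      unfold ContravariantConnection.sectionalCurvature at h1
      rw [hD.cometric_curvature_liftSnd hg₁ hg₂ hf hP₁ hcas isPoissonTensor_zero
        (isLeviCivita_zeroConnection g₂)] at h1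
      simp [hν] at h1
    rw [hP₂.eq_zero_of_forall_not_linearIndependent hno]
    exact ⟨zeroConnection I₂ M₂, isLeviCivita_zeroConnection g₂,
      fun q α β h => absurd h (hno q α β)⟩

end Main

end PositiveCurvature

end

theorem theorem3p2
    {E₁ : Type*} [NormedAddCommGroup E₁] [NormedSpace ℝ E₁] [FiniteDimensional ℝ E₁]
    {H₁ : Type*} [TopologicalSpace H₁] (I₁ : ModelWithCorners ℝ E₁ H₁) [I₁.Boundaryless]
    {M₁ : Type*} [TopologicalSpace M₁] [ChartedSpace H₁ M₁] [IsManifold I₁ ∞ M₁]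
    [T2Space M₁] [SecondCountableTopology M₁] [Nonempty M₁]
    {E₂ : Type*} [NormedAddCommGroup E₂] [NormedSpace ℝ E₂] [FiniteDimensional ℝ E₂]
    {H₂ : Type*} [TopologicalSpace H₂] (I₂ : ModelWithCorners ℝ E₂ H₂) [I₂.Boundaryless]
    {M₂ : Type*} [TopologicalSpace M₂] [ChartedSpace H₂ M₂] [IsManifold I₂ ∞ M₂]
    [T2Space M₂] [SecondCountableTopology M₂] [Nonempty M₂]
    (P₁ : ContraTwoTensor I₁ M₁) (hP₁ : IsPoissonTensor P₁)
    (P₂ : ContraTwoTensor I₂ M₂) (hP₂ : IsPoissonTensor P₂)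
    (g₁ : ContMDiffRiemannianMetric I₁ ∞ E₁ (fun x : M₁ => TangentSpace I₁ x))
    (g₂ : ContMDiffRiemannianMetric I₂ ∞ E₂ (fun x : M₂ => TangentSpace I₂ x))
    (f₁ ν₁ : C^∞⟮I₁, M₁; ℝ⟯) (hf₁ : ∀ p, 0 < f₁ p) (hcas : IsCasimir P₁ f₁)
    (hM : HasPositiveSectionalCurvature (warpedBivector P₁ P₂ ν₁)
      (warpedMetric g₁.inner g₂.inner f₁)) :
    (IsPoissonTensor P₁ ∧ HasPositiveSectionalCurvature P₁ g₁.inner) ∧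
      (IsPoissonTensor P₂ ∧ HasPositiveSectionalCurvature P₂ g₂.inner) := by
  exact ⟨⟨hP₁, hasPositiveSectionalCurvature_fst (isInnerField_inner g₁) (isInnerField_inner g₂) hf₁
      hP₁ hP₂ hM⟩, hP₂, hasPositiveSectionalCurvature_snd (isInnerField_inner g₁)
      (isInnerField_inner g₂) hf₁ hP₁ hP₂ hcas hM⟩
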